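/- Let $\mathbb F\in\{\mathbb R,\mathbb C\}$. Let $M$ be a connected smooth Riemannian manifold with possibly empty smooth boundary, and let $E\to M$ be a smooth vector bundle over $\mathbb F$ of finite rank with a smooth Riemannian (if $\mathbb F=\mathbb R$) or Hermitian (if $\mathbb F=\mathbb C$) fibre metric, endowed with a (not necessarily metric) connection $\nabla$. Let $D\colon\Gamma(E)\to\Gamma(E)$ be a (not necessarily elliptic) differential operator of finite order with smooth coefficients. Let $a,b\colon\partial M\to\mathbb F$ be arbitrary functions, let $n$ be the inward pointing unit normal to $\partial M$, and set $$\mathcal D(D)=\{\eta\in\Gamma_c(E): a\,\nabla_n\eta+b\,\eta=0\text{ on }\partial M\}$$ (so $\mathcal D(D)=\Gamma_c(E)$ if $\partial M=\emptyset$), where $\Gamma_c(E)$ is the space of smooth sections with compact support. Regard $D\colon\mathcal D(D)\subset L^2(E)\to L^2(E)$ as a densely defined operator. Let $\Gamma$ be a group of automorphisms of $E$ which preserve the metric of $E$ and induce isometries of $M$, such that $D(g_*\eta)=g_*(D\eta)$ for all $g\in\Gamma$ and $\eta\in\Gamma(E)$. If $\partial M\neq\emptyset$, assume moreover that $\nabla$,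 $a$ and $b$ are $\Gamma$-invariant along the boundary. Assume that for every compact $K\subset M$ there exists $g\in\Gamma$ with $gK\cap K=\emptyset$. Assume that $D$ (with domain $\mathcal D(D)$) is symmetric and bounded from below, that is, there is $c\in\mathbb R$ with $\langle D\eta,\eta\rangle\ge c\|\eta\|^2$ for all $\eta\in\mathcal D(D)$, and let $D^{(F)}$ be its Friedrichs extension. Then $\sigma(D^{(F)})=\sigma_{\mathrm{ess}}(D^{(F)})$, and $D^{(F)}$ has no eigenvalues of finite multiplicity. Here $\sigma(A)$ is the set of $\lambda\in\mathbb F$ for which $A-\lambda\colon\mathcal D(A)\to L^2(E)$ is not bijective, and $\sigma_{\mathrm{ess}}(A)$ is the set of $\lambda\in\mathbb F$ for which $A-\lambda$ is not Fredholm, i.e. does not have both finite-dimensional kernel and closed range of finite codimension. -/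

import Mathlib

open Set Filter Topology MeasureTheory Bundle Manifold
open scoped ContDiff ENNReal

set_option linter.unusedSectionVars false

noncomputable section

namespace LinearPMap

variable {𝕜 H : Type*} [RCLike 𝕜] [NormedAddCommGroup H] [InnerProductSpace 𝕜 H]

/-- The linear map `A - z` on the domain of `A`. -/
def subScalar (A : H →ₗ.[𝕜] H) (z : 𝕜) : A.domain →ₗ[𝕜] H :=
  A.toFun - z • A.domain.subtype

/-- The spectrum: all `z` such that `A - z : D(A) → H` is not bijective. -/
def spectrumSet (A : H →ₗ.[𝕜] H) : Set 𝕜 :=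
  {z | ¬ Function.Bijective (A.subScalar z)}

/-- The essential spectrum: all `z` such that `A - z : D(A) → H` is not Fredholm, i.e. such that
it is not the case that its kernel is finite dimensional and its range is closed and of finite
codimension. -/
def essentialSpectrum (A : H →ₗ.[𝕜] H) : Set 𝕜 :=
  {z | ¬ (FiniteDimensional 𝕜 (LinearMap.ker (A.subScalar z)) ∧
    _root_.IsClosed (LinearMap.range (A.subScalar z) : Set H) ∧
    FiniteDimensional 𝕜 (H ⧸ LinearMap.range (A.subScalar z)))}

/-- `z` is an eigenvalue of `A` if `A v = z v` for some nonzero `v` in the domain of `A`. -/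
def IsEigenvalue (A : H →ₗ.[𝕜] H) (z : 𝕜) : Prop :=
  ∃ v : A.domain, v ≠ 0 ∧ A v = z • (v : H)

/-- The eigenspace of `A` for `z` is finite dimensional. -/
def HasFiniteMultiplicity (A : H →ₗ.[𝕜] H) (z : 𝕜) : Prop :=
  FiniteDimensional 𝕜 (LinearMap.ker (A.subScalar z))

/-- `⟨A u, v⟩ = ⟨u, A v⟩` on the domain of `A`. -/
def IsSymmetricOp (A : H →ₗ.[𝕜] H) : Prop :=
  ∀ u v : A.domain, inner 𝕜 (A u) (v : H) = inner 𝕜 (u : H) (A v)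

/-- The quadratic form `v ↦ Re ⟨A v, v⟩` on the domain of `A`. -/
def quadForm (A : H →ₗ.[𝕜] H) (v : A.domain) : ℝ :=
  RCLike.re (inner 𝕜 (A v) (v : H))

/-- The Rayleigh quotients of `A` are bounded from below. -/
def IsBoundedFromBelow (A : H →ₗ.[𝕜] H) : Prop :=
  ∃ c : ℝ, ∀ v : A.domain, c * ‖(v : H)‖ ^ 2 ≤ A.quadForm v

theorem quadForm_smul (A : H →ₗ.[𝕜] H) (c : 𝕜) (v : A.domain) :
    A.quadForm (c • v) = ‖c‖ ^ 2 * A.quadForm v := by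
  unfold quadForm
  rw [A.map_smul, Submodule.coe_smul, inner_smul_left, inner_smul_right, ← mul_assoc,
    RCLike.conj_mul, ← RCLike.ofReal_pow, RCLike.re_ofReal_mul]

theorem quadForm_parallelogram (A : H →ₗ.[𝕜] H) (u v : A.domain) :
    A.quadForm (u + v) + A.quadForm (u - v) = 2 * A.quadForm u + 2 * A.quadForm v := by
  unfold quadForm
  rw [A.map_add, A.map_sub, Submodule.coe_add, Submodule.coe_sub]
  simp only [inner_add_left, inner_add_right, inner_sub_left, inner_sub_right]
  simp only [_root_.map_add, _root_.map_sub]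
  ring

/-- The form domain of an operator bounded from below, i.e. the domain of the closure of its
quadratic form `q`: all limits in `H` of sequences `(u k)` in the domain of `A` with
`q (u k - u l) → 0` as `k, l → ∞`. -/
def formDomain (A : H →ₗ.[𝕜] H) (hA : A.IsBoundedFromBelow) : Submodule 𝕜 H where
  carrier := {v | ∃ u : ℕ → A.domain, Tendsto (fun k => (u k : H)) atTop (𝓝 v) ∧
    Tendsto (fun p : ℕ × ℕ => A.quadForm (u p.1 - u p.2)) atTop (𝓝 0)}
  zero_mem' := ⟨fun _ => 0, by simp, by simp [quadForm]⟩
  smul_mem' := by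
    rintro c v ⟨u, hu, hq⟩
    refine ⟨fun k => c • u k, ?_, ?_⟩
    · simpa using hu.const_smul c
    · simp only [← smul_sub, quadForm_smul]
      simpa using hq.const_mul (‖c‖ ^ 2)
  add_mem' := by
    rintro v w ⟨u, hu, hq⟩ ⟨t, ht, hr⟩
    obtain ⟨c, hc⟩ := hA
    refine ⟨fun k => u k + t k, by simpa using hu.add ht, ?_⟩
    have cau : ∀ {x : H} {s : ℕ → A.domain}, Tendsto (fun k => (s k : H)) atTop (𝓝 x) →
        Tendsto (fun p : ℕ × ℕ => ‖((s p.1 - s p.2 : A.domain) : H)‖ ^ 2) atTop (𝓝 0) := by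
      intro x s hs
      have h1 : Tendsto (fun p : ℕ × ℕ => (s p.1 : H) - (s p.2 : H)) atTop (𝓝 (x - x)) := by
        rw [← prod_atTop_atTop_eq]
        exact (hs.comp tendsto_fst).sub (hs.comp tendsto_snd)
      simpa using (h1.norm.pow 2)
    have hsum := hu.add ht
    have hd := hu.sub ht
    have lo := (cau (s := fun k => u k + t k) (by simpa using hsum)).const_mul c
    have hi := ((hq.const_mul 2).add (hr.const_mul 2)).sub
      ((cau (s := fun k => u k - t k) (by simpa using hd)).const_mul c)
    simp only [mul_zero, add_zero, sub_zero] at lo hi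
    refine tendsto_of_tendsto_of_tendsto_of_le_of_le lo hi (fun p => hc _) (fun p => ?_)
    have h1 := A.quadForm_parallelogram (u p.1 - u p.2) (t p.1 - t p.2)
    have h2 := hc ((u p.1 - u p.2) - (t p.1 - t p.2))
    have e1 : u p.1 + t p.1 - (u p.2 + t p.2) = (u p.1 - u p.2) + (t p.1 - t p.2) := by abel
    have e2 : u p.1 - t p.1 - (u p.2 - t p.2) = (u p.1 - u p.2) - (t p.1 - t p.2) := by abel
    simp only [e1, e2]
    linarith

/-- The Friedrichs extension of a densely defined symmetric operator bounded from below: the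
restriction of the adjoint of `A` to the form domain of `A`. -/
def friedrichs [CompleteSpace H] (A : H →ₗ.[𝕜] H) (hA : A.IsBoundedFromBelow) : H →ₗ.[𝕜] H :=
  (LinearPMap.adjoint A).domRestrict (A.formDomain hA)

end LinearPMap

section Volume
variable {m : ℕ} {H : Type*} [TopologicalSpace H]
  (I : ModelWithCorners ℝ (EuclideanSpace ℝ (Fin m)) H)
  (M : Type*) [TopologicalSpace M] [ChartedSpace H M]

/-- The model is the whole Euclidean space or a closed coordinate half-space; manifolds modelled
on it are manifolds with possibly empty smooth boundary (no corners). -/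
def IsHalfSpaceModel {m : ℕ} {H : Type*} [TopologicalSpace H]
    (I : ModelWithCorners ℝ (EuclideanSpace ℝ (Fin m)) H) : Prop :=
  range I = univ ∨ ∃ i : Fin m, range I = {v | 0 ≤ v i}

variable [RiemannianBundle (fun x : M ↦ TangentSpace I x)]

/-- The density `√(det g_ij)` of the metric in the chart at `x₀`, with
`g_ij = ⟨∂_i, ∂_j⟩` and `∂_i` (`X i` below) the coordinate vector fields. -/
def chartDensity (x₀ : M) (u : EuclideanSpace ℝ (Fin m)) : ℝ :=
  let X (i : Fin m) : TangentSpace I ((extChartAt I x₀).symm u) :=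
    mfderivWithin 𝓘(ℝ, EuclideanSpace ℝ (Fin m)) I (extChartAt I x₀).symm (range I) u
      (EuclideanSpace.single i (1 : ℝ))
  √(Matrix.det (Matrix.of fun i j => inner ℝ (X i) (X j)))

variable [MeasurableSpace M]

/-- The Riemannian measure on the domain of the chart at `x₀`: the image of `√(det g_ij) du`. -/
def chartVolume (x₀ : M) : Measure M :=
  ((volume.restrict (extChartAt I x₀).target).withDensity
    fun u => ENNReal.ofReal (chartDensity I M x₀ u)).map (extChartAt I x₀).symm

theorem exists_seq_chart_cover [SecondCountableTopology M] [Nonempty M] :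
    ∃ c : ℕ → M, ⋃ n, (chartAt H (c n)).source = univ := by
  obtain ⟨s, hs, hU⟩ := TopologicalSpace.countable_cover_nhds
    (fun x : M => chart_source_mem_nhds H x)
  have hne : s.Nonempty := by
    by_contra h
    rw [not_nonempty_iff_eq_empty] at h
    rw [h, biUnion_empty] at hU
    exact empty_ne_univ hU
  obtain ⟨c, rfl⟩ := hs.exists_eq_range hne
  exact ⟨c, by simpa using hU⟩

/-- The Riemannian volume measure: cut `M` into countably many disjoint Borel pieces, each inside
a chart domain, and use `√(det g_ij) du` on each of them. (By the change of variables formula the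
result does not depend on the choice of the pieces and charts.) -/
def riemannianVolume [SecondCountableTopology M] [Nonempty M] : Measure M :=
  let c : ℕ → M := (exists_seq_chart_cover (H := H) M).choose
  Measure.sum fun n => (chartVolume I M (c n)).restrict
    (disjointed (fun k => (chartAt H (c k)).source) n)
end Volume

section Sections

variable (𝕜 : Type*) [RCLike 𝕜] {m : ℕ} {H : Type*} [TopologicalSpace H]
  (I : ModelWithCorners ℝ (EuclideanSpace ℝ (Fin m)) H)
  {M : Type*} [TopologicalSpace M] [ChartedSpace H M]
  (F : Type*) [NormedAddCommGroup F] [NormedSpace 𝕜 F] [NormedSpace ℝ F] [IsScalarTower ℝ 𝕜 F]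
  (V : M → Type*) [TopologicalSpace (TotalSpace F V)]
  [∀ x, NormedAddCommGroup (V x)] [∀ x, InnerProductSpace 𝕜 (V x)]
  [∀ x, NormedSpace ℝ (V x)] [∀ x, IsScalarTower ℝ 𝕜 (V x)]
  [FiberBundle F V] [VectorBundle 𝕜 F V] [VectorBundle ℝ F V]

/-- The fibre metric is smooth: the inner product of any two smooth sections over an open set is a
smooth function. -/
class IsSmoothFiberMetric : Prop where
  contMDiffOn_inner : ∀ (U : Set M), IsOpen U → ∀ σ τ : (∀ x, V x),
    ContMDiffOn I (I.prod 𝓘(ℝ, F)) ∞ (fun x => TotalSpace.mk' F x (σ x)) U →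
    ContMDiffOn I (I.prod 𝓘(ℝ, F)) ∞ (fun x => TotalSpace.mk' F x (τ x)) U →
    ContMDiffOn I 𝓘(ℝ, 𝕜) ∞ (fun x => inner 𝕜 (σ x) (τ x)) U

/-- The space of measurable sections: those which are (a.e.) measurable in every distinguished
local trivialization. -/
def measurableSections [MeasurableSpace M] [BorelSpace M] (μ : Measure M) :
    Submodule 𝕜 (∀ x, V x) where
  carrier := {σ | ∀ x₀ : M, AEStronglyMeasurable (fun x => (trivializationAt F V x₀ ⟨x, σ x⟩).2)
    (μ.restrict (trivializationAt F V x₀).baseSet)}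
  zero_mem' x₀ := by
    refine (aestronglyMeasurable_const (b := (0 : F))).congr ?_
    refine ae_restrict_of_forall_mem (trivializationAt F V x₀).open_baseSet.measurableSet ?_
    intro x hx
    exact (((trivializationAt F V x₀).linear 𝕜 hx).map_zero).symm
  add_mem' {σ τ} hσ hτ x₀ := by
    refine ((hσ x₀).add (hτ x₀)).congr ?_
    refine ae_restrict_of_forall_mem (trivializationAt F V x₀).open_baseSet.measurableSet ?_
    intro x hx
    exact (((trivializationAt F V x₀).linear 𝕜 hx).map_add (σ x) (τ x)).symm
  smul_mem' c {σ} hσ x₀ := by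
    refine ((hσ x₀).const_smul c).congr ?_
    refine ae_restrict_of_forall_mem (trivializationAt F V x₀).open_baseSet.measurableSet ?_
    intro x hx
    exact (((trivializationAt F V x₀).linear 𝕜 hx).map_smul c (σ x)).symm

variable {𝕜 F V} [FiniteDimensional 𝕜 F] [ContMDiffVectorBundle ∞ F V I]
  [SecondCountableTopology M] [MeasurableSpace M] [BorelSpace M] {μ : Measure M}

theorem aestronglyMeasurable_inner_section [IsSmoothFiberMetric 𝕜 I F V] {σ τ : ∀ x, V x}
    (hσ : σ ∈ measurableSections 𝕜 F V μ) (hτ : τ ∈ measurableSections 𝕜 F V μ) :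
    AEStronglyMeasurable (fun x => inner 𝕜 (σ x) (τ x)) μ := by
  obtain ⟨s, hs, hU⟩ := TopologicalSpace.countable_cover_nhds
    (fun x : M => (trivializationAt F V x).open_baseSet.mem_nhds
      (mem_baseSet_trivializationAt F V x))
  have := hs.to_subtype
  rw [biUnion_eq_iUnion] at hU
  rw [← Measure.restrict_univ (μ := μ), ← hU, aestronglyMeasurable_iUnion_iff]
  rintro ⟨x₀, -⟩
  set e := trivializationAt F V x₀ with he
  let b := Module.finBasis 𝕜 F
  let f : Fin (Module.finrank 𝕜 F) → ∀ x, V x := fun i x => e.symm x (b i)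
  have hf : ∀ i, ContMDiffOn I (I.prod 𝓘(ℝ, F)) ∞ (fun x => TotalSpace.mk' F x (f i x))
      e.baseSet := by
    intro i
    have h1 : ContMDiffOn I (I.prod 𝓘(ℝ, F)) ∞ (fun x : M => (x, b i)) e.baseSet :=
      contMDiffOn_id.prodMk contMDiffOn_const
    refine ((e.contMDiffOn_symm (IB := I) (n := ∞)).comp h1 ?_).congr ?_
    · intro x hx
      exact e.mem_target.2 hx
    · intro x hx
      exact e.mk_symm hx (b i)
  have hg : ∀ i j, AEStronglyMeasurable (fun x => inner 𝕜 (f i x) (f j x))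
      (μ.restrict e.baseSet) :=
    fun i j => (IsSmoothFiberMetric.contMDiffOn_inner (𝕜 := 𝕜) (I := I) e.baseSet e.open_baseSet _ _
      (hf i) (hf j)).continuousOn.aestronglyMeasurable e.open_baseSet.measurableSet
  have hc : ∀ {ρ : ∀ x, V x}, ρ ∈ measurableSections 𝕜 F V μ → ∀ i,
      AEStronglyMeasurable (fun x => b.repr (e ⟨x, ρ x⟩).2 i) (μ.restrict e.baseSet) := by
    intro ρ hρ i
    exact (LinearMap.continuous_of_finiteDimensional (b.coord i)).comp_aestronglyMeasurable (hρ x₀)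
  have hexp : ∀ (ρ : ∀ x, V x) {x}, x ∈ e.baseSet →
      ρ x = ∑ i, b.repr (e ⟨x, ρ x⟩).2 i • f i x := by
    intro ρ x hx
    have h1 : e.symmₗ 𝕜 x (e ⟨x, ρ x⟩).2 = ρ x := by
      rw [e.symmₗ_apply hx]
      exact e.symm_proj_apply ⟨x, ρ x⟩ hx
    conv_lhs => rw [← h1, ← b.sum_repr (e ⟨x, ρ x⟩).2]
    rw [map_sum]
    refine Finset.sum_congr rfl fun i _ => ?_
    rw [map_smul, e.symmₗ_apply hx]
  refine AEStronglyMeasurable.congr (f := fun x => ∑ i, ∑ j,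
    (b.repr (e ⟨x, τ x⟩).2 j *
      ((starRingEnd 𝕜) (b.repr (e ⟨x, σ x⟩).2 i) * inner 𝕜 (f i x) (f j x))))
    ?_ ?_
  · refine Finset.aestronglyMeasurable_fun_sum _ fun i _ =>
      Finset.aestronglyMeasurable_fun_sum _ fun j _ => ?_
    exact (hc hτ j).mul ((RCLike.continuous_conj.comp_aestronglyMeasurable (hc hσ i)).mul (hg i j))
  · refine ae_restrict_of_forall_mem e.open_baseSet.measurableSet fun x hx => ?_
    beta_reduce
    conv_rhs => rw [hexp σ hx, hexp τ hx]
    simp only [sum_inner, inner_sum, inner_smul_left, inner_smul_right]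
    rw [Finset.sum_comm]
    simp only [Finset.mul_sum]

theorem aestronglyMeasurable_norm_section [IsSmoothFiberMetric 𝕜 I F V] {σ : ∀ x, V x}
    (hσ : σ ∈ measurableSections 𝕜 F V μ) : AEStronglyMeasurable (fun x => ‖σ x‖) μ := by
  have h := aestronglyMeasurable_inner_section I hσ hσ
  have h2 := Real.continuous_sqrt.comp_aestronglyMeasurable
    (RCLike.continuous_re.comp_aestronglyMeasurable h)
  refine h2.congr (Eventually.of_forall fun x => ?_)
  exact (norm_eq_sqrt_re_inner (𝕜 := 𝕜) (σ x)).symm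

variable (𝕜 F V μ)

/-- The space of square-integrable measurable sections. -/
def sqIntegrableSections [IsSmoothFiberMetric 𝕜 I F V] : Submodule 𝕜 (∀ x, V x) where
  carrier := {σ | σ ∈ measurableSections 𝕜 F V μ ∧ MemLp (fun x => ‖σ x‖) 2 μ}
  zero_mem' := ⟨zero_mem _, by simp⟩
  add_mem' := by
    rintro σ τ ⟨hσ, hσ'⟩ ⟨hτ, hτ'⟩
    have h := add_mem hσ hτ
    refine ⟨h, (hσ'.add hτ').mono (aestronglyMeasurable_norm_section I h)
      (Eventually.of_forall fun x => ?_)⟩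
    simp only [norm_norm, Pi.add_apply]
    exact (norm_add_le _ _).trans (le_abs_self _)
  smul_mem' c σ := by
    rintro ⟨hσ, hσ'⟩
    have h := Submodule.smul_mem _ c hσ
    refine ⟨h, (hσ'.const_mul ‖c‖).congr_norm (aestronglyMeasurable_norm_section I h)
      (Eventually.of_forall fun x => ?_)⟩
    simp [norm_smul]

variable [IsSmoothFiberMetric 𝕜 I F V]

/-- The square-integrable sections, with the semi-inner product `∫ ⟨σ, τ⟩ dμ`. -/
def PreL2Section : Type _ := sqIntegrableSections 𝕜 I F V μ

instance : AddCommGroup (PreL2Section 𝕜 I F V μ) :=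
  inferInstanceAs (AddCommGroup (sqIntegrableSections 𝕜 I F V μ))

instance : Module 𝕜 (PreL2Section 𝕜 I F V μ) :=
  inferInstanceAs (Module 𝕜 (sqIntegrableSections 𝕜 I F V μ))

variable {𝕜 I F V μ}

/-- The section underlying an element of `PreL2Section`. -/
def PreL2Section.val (σ : PreL2Section 𝕜 I F V μ) : ∀ x, V x := Subtype.val σ

theorem PreL2Section.mem (σ : PreL2Section 𝕜 I F V μ) : σ.val ∈ sqIntegrableSections 𝕜 I F V μ :=
  Subtype.property σ

theorem PreL2Section.integrable_inner (σ τ : PreL2Section 𝕜 I F V μ) :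
    Integrable (fun x => inner 𝕜 (σ.val x) (τ.val x)) μ := by
  refine (σ.mem.2.integrable_mul τ.mem.2).mono
    (aestronglyMeasurable_inner_section I σ.mem.1 τ.mem.1) (Eventually.of_forall fun x => ?_)
  refine (norm_inner_le_norm (𝕜 := 𝕜) _ _).trans (le_abs_self _)

instance PreL2Section.core : PreInnerProductSpace.Core 𝕜 (PreL2Section 𝕜 I F V μ) where
  inner σ τ := ∫ x, inner 𝕜 (σ.val x) (τ.val x) ∂μ
  conj_inner_symm σ τ := by
    rw [← integral_conj]
    simp only [inner_conj_symm]
  re_inner_nonneg σ := by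
    rw [← integral_re (σ.integrable_inner σ)]
    exact integral_nonneg fun x => inner_self_nonneg
  add_left σ τ ρ := by
    rw [← integral_add (σ.integrable_inner ρ) (τ.integrable_inner ρ)]
    exact integral_congr_ae (Eventually.of_forall fun x => inner_add_left _ _ _)
  smul_left σ τ c := by
    rw [← integral_const_mul]
    exact integral_congr_ae (Eventually.of_forall fun x => inner_smul_left _ _ _)

instance : SeminormedAddCommGroup (PreL2Section 𝕜 I F V μ) :=
  InnerProductSpace.Core.toSeminormedAddCommGroup (𝕜 := 𝕜)

instance : InnerProductSpace 𝕜 (PreL2Section 𝕜 I F V μ) :=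
  InnerProductSpace.ofCore _

theorem PreL2Section.norm_sq_eq (σ : PreL2Section 𝕜 I F V μ) :
    ‖σ‖ ^ 2 = ∫ x, ‖σ.val x‖ ^ 2 ∂μ := by
  rw [← inner_self_eq_norm_sq (𝕜 := 𝕜) σ]
  change RCLike.re (∫ x, inner 𝕜 (σ.val x) (σ.val x) ∂μ) = _
  rw [← integral_re (σ.integrable_inner σ)]
  simp only [inner_self_eq_norm_sq]

theorem PreL2Section.lintegral_sq_eq (σ : PreL2Section 𝕜 I F V μ) :
    ∫⁻ x, ENNReal.ofReal (‖σ.val x‖ ^ 2) ∂μ = ENNReal.ofReal (‖σ‖ ^ 2) := by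
  rw [σ.norm_sq_eq, ofReal_integral_eq_lintegral_ofReal σ.mem.2.integrable_sq
    (Eventually.of_forall fun x => sq_nonneg _)]

theorem mem_sqIntegrableSections_of_lintegral {σ : ∀ x, V x}
    (hσ : σ ∈ measurableSections 𝕜 F V μ)
    (h : ∫⁻ x, ENNReal.ofReal (‖σ x‖ ^ 2) ∂μ ≠ ⊤) : σ ∈ sqIntegrableSections 𝕜 I F V μ := by
  have hm := aestronglyMeasurable_norm_section I hσ
  refine ⟨hσ, (memLp_two_iff_integrable_sq hm).2 ⟨hm.pow 2, ?_⟩⟩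
  rw [hasFiniteIntegral_iff_ofReal (Eventually.of_forall fun x => sq_nonneg _)]
  exact h.lt_top

instance PreL2Section.completeSpace : CompleteSpace (PreL2Section 𝕜 I F V μ) := by
  refine Metric.complete_of_convergent_controlled_sequences (fun n => (1 / 4 : ℝ) ^ n)
    (fun n => by positivity) fun u hu => ?_
  have hfin : ∀ x, CompleteSpace (V x) := fun x => by
    let L := (trivializationAt F V x).continuousLinearEquivAt 𝕜 x
      (mem_baseSet_trivializationAt F V x)
    have : FiniteDimensional 𝕜 (V x) := L.symm.toLinearEquiv.finiteDimensional
    exact FiniteDimensional.complete 𝕜 (V x)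
  have hd : ∀ N n m, N ≤ n → N ≤ m →
      ∫⁻ x, ENNReal.ofReal (‖(u n).val x - (u m).val x‖ ^ 2) ∂μ
        ≤ ENNReal.ofReal ((1 / 16 : ℝ) ^ N) := by
    intro N n m hn hm
    refine ((u n - u m).lintegral_sq_eq).trans_le (ENNReal.ofReal_le_ofReal ?_)
    have h1 := (hu N n m hn hm).le
    rw [dist_eq_norm] at h1
    calc ‖u n - u m‖ ^ 2 ≤ ((1 / 4 : ℝ) ^ N) ^ 2 := pow_le_pow_left₀ (norm_nonneg _) h1 2
      _ = (1 / 16 : ℝ) ^ N := by rw [← pow_mul, mul_comm, pow_mul]; norm_num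
  have hmeas : ∀ n m, AEStronglyMeasurable (fun x => ‖(u n).val x - (u m).val x‖) μ := fun n m =>
    aestronglyMeasurable_norm_section I (u n - u m).mem.1
  have hmeas' : ∀ n, AEMeasurable
      (fun x => ENNReal.ofReal (4 ^ n * ‖(u n).val x - (u (n + 1)).val x‖ ^ 2)) μ := fun n =>
    (((hmeas n (n + 1)).pow 2).const_mul (4 ^ n : ℝ)).aemeasurable.ennreal_ofReal
  have hS : ∫⁻ x, ∑' n, ENNReal.ofReal (4 ^ n * ‖(u n).val x - (u (n + 1)).val x‖ ^ 2) ∂μ ≠ ⊤ := by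
    rw [lintegral_tsum hmeas']
    have hle : ∀ n, ∫⁻ x, ENNReal.ofReal (4 ^ n * ‖(u n).val x - (u (n + 1)).val x‖ ^ 2) ∂μ
        ≤ ENNReal.ofReal ((1 / 4 : ℝ) ^ n) := by
      intro n
      simp_rw [ENNReal.ofReal_mul (show (0 : ℝ) ≤ 4 ^ n by positivity)]
      rw [lintegral_const_mul' _ _ ENNReal.ofReal_ne_top]
      refine (mul_le_mul_right (hd n n (n + 1) le_rfl (Nat.le_succ n)) _).trans_eq ?_
      rw [← ENNReal.ofReal_mul (by positivity), ← mul_pow]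
      norm_num
    refine ne_top_of_le_ne_top ?_ (ENNReal.tsum_le_tsum hle)
    rw [← ENNReal.ofReal_tsum_of_nonneg (fun n => by positivity)
      (summable_geometric_of_lt_one (by norm_num) (by norm_num))]
    exact ENNReal.ofReal_ne_top
  have hlim : ∀ᵐ x ∂μ, ∃ y, Tendsto (fun n => (u n).val x) atTop (𝓝 y) := by
    have hae := ae_lt_top' (AEMeasurable.tsum hmeas') hS
    filter_upwards [hae] with x hx
    have := hfin x
    set S := ∑' n, ENNReal.ofReal (4 ^ n * ‖(u n).val x - (u (n + 1)).val x‖ ^ 2) with hSx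
    refine cauchySeq_tendsto_of_complete
      (cauchySeq_of_le_geometric (1 / 2 : ℝ) √S.toReal (by norm_num) fun n => ?_)
    have h1 : 4 ^ n * ‖(u n).val x - (u (n + 1)).val x‖ ^ 2 ≤ S.toReal := by
      rw [← ENNReal.ofReal_le_iff_le_toReal hx.ne]
      exact ENNReal.le_tsum n
    rw [dist_eq_norm, ← abs_of_nonneg (show 0 ≤ √S.toReal * (1 / 2 : ℝ) ^ n by positivity),
      ← abs_of_nonneg (norm_nonneg _)]
    refine sq_le_sq.1 ?_
    rw [mul_pow, Real.sq_sqrt ENNReal.toReal_nonneg, ← pow_mul, mul_comm n 2, pow_mul,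
      show ((1 / 2 : ℝ) ^ 2) = 4⁻¹ by norm_num, inv_pow, ← div_eq_mul_inv,
      le_div_iff₀ (by positivity), mul_comm]
    exact h1
  classical
  let g : ∀ x, V x := fun x =>
    if h : ∃ y, Tendsto (fun n => (u n).val x) atTop (𝓝 y) then h.choose else 0
  have hg : ∀ᵐ x ∂μ, Tendsto (fun n => (u n).val x) atTop (𝓝 (g x)) := by
    filter_upwards [hlim] with x hx
    simp only [g, dif_pos hx]
    exact hx.choose_spec
  have hgm : g ∈ measurableSections 𝕜 F V μ := by
    intro x₀
    refine aestronglyMeasurable_of_tendsto_ae atTop (fun n => (u n).mem.1 x₀) ?_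
    filter_upwards [ae_restrict_of_ae hg,
      ae_restrict_mem (trivializationAt F V x₀).open_baseSet.measurableSet] with x hx hx₀
    have := (((trivializationAt F V x₀).continuousLinearEquivAt 𝕜 x
      hx₀).continuous.tendsto _).comp hx
    simpa [Function.comp_def] using this
  have hgd : ∀ n, ∫⁻ x, ENNReal.ofReal (‖g x - (u n).val x‖ ^ 2) ∂μ
      ≤ ENNReal.ofReal ((1 / 16 : ℝ) ^ n) := by
    intro n
    have h1 : ∫⁻ x, ENNReal.ofReal (‖g x - (u n).val x‖ ^ 2) ∂μ
        = ∫⁻ x, liminf (fun k => ENNReal.ofReal (‖(u k).val x - (u n).val x‖ ^ 2)) atTop ∂μ := by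
      refine lintegral_congr_ae ?_
      filter_upwards [hg] with x hx
      exact (((ENNReal.continuous_ofReal.tendsto _).comp
        ((hx.sub_const _).norm.pow 2)).liminf_eq).symm
    rw [h1]
    refine (lintegral_liminf_le' fun k =>
      ((hmeas k n).pow 2).aemeasurable.ennreal_ofReal).trans ?_
    refine liminf_le_of_frequently_le' (Eventually.frequently ?_)
    filter_upwards [eventually_ge_atTop n] with k hk
    exact hd n k n hk le_rfl
  have hg0 : g - (u 0).val ∈ sqIntegrableSections 𝕜 I F V μ :=
    mem_sqIntegrableSections_of_lintegral (sub_mem hgm (u 0).mem.1)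
      (ne_top_of_le_ne_top ENNReal.ofReal_ne_top (hgd 0))
  have hgs : g ∈ sqIntegrableSections 𝕜 I F V μ := by
    have := add_mem hg0 (u 0).mem
    rwa [sub_add_cancel] at this
  let G : PreL2Section 𝕜 I F V μ := ⟨g, hgs⟩
  refine ⟨G, tendsto_iff_norm_sub_tendsto_zero.2 ?_⟩
  refine squeeze_zero (fun n => norm_nonneg _) (g := fun n => (1 / 4 : ℝ) ^ n) (fun n => ?_)
    (tendsto_pow_atTop_nhds_zero_of_lt_one (by norm_num) (by norm_num))
  have h1 : ENNReal.ofReal (‖G - u n‖ ^ 2) ≤ ENNReal.ofReal ((1 / 16 : ℝ) ^ n) :=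
    ((G - u n).lintegral_sq_eq).symm.trans_le (hgd n)
  rw [ENNReal.ofReal_le_ofReal_iff (by positivity)] at h1
  rw [norm_sub_rev, ← abs_of_nonneg (show (0 : ℝ) ≤ (1 / 4) ^ n by positivity),
    ← abs_of_nonneg (norm_nonneg (G - u n))]
  refine sq_le_sq.1 (h1.trans_eq ?_)
  rw [← pow_mul, mul_comm, pow_mul]
  norm_num

variable (𝕜 I F V μ) in
/-- The Hilbert space `L²(V)`: square-integrable sections modulo sections of norm zero, that is,
modulo equality almost everywhere. -/
def L2Section : Type _ := SeparationQuotient (PreL2Section 𝕜 I F V μ)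

instance : NormedAddCommGroup (L2Section 𝕜 I F V μ) :=
  inferInstanceAs (NormedAddCommGroup (SeparationQuotient (PreL2Section 𝕜 I F V μ)))

instance : InnerProductSpace 𝕜 (L2Section 𝕜 I F V μ) :=
  inferInstanceAs (InnerProductSpace 𝕜 (SeparationQuotient (PreL2Section 𝕜 I F V μ)))

instance : CompleteSpace (L2Section 𝕜 I F V μ) :=
  inferInstanceAs (CompleteSpace (SeparationQuotient (PreL2Section 𝕜 I F V μ)))

/-- The class in `L²(V)` of a square-integrable section. -/
def L2Section.mk (σ : ∀ x, V x) (hσ : σ ∈ sqIntegrableSections 𝕜 I F V μ) : L2Section 𝕜 I F V μ :=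
  SeparationQuotient.mk (⟨σ, hσ⟩ : PreL2Section 𝕜 I F V μ)

end Sections

section Operators

variable (𝕜 : Type*) [RCLike 𝕜] {m : ℕ} {H : Type*} [TopologicalSpace H]
  (I : ModelWithCorners ℝ (EuclideanSpace ℝ (Fin m)) H)
  {M : Type*} [TopologicalSpace M] [ChartedSpace H M]
  (F : Type*) [NormedAddCommGroup F] [NormedSpace 𝕜 F] [NormedSpace ℝ F] [IsScalarTower ℝ 𝕜 F]
  (V : M → Type*) [TopologicalSpace (TotalSpace F V)]
  [∀ x, NormedAddCommGroup (V x)] [∀ x, InnerProductSpace 𝕜 (V x)]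
  [∀ x, NormedSpace ℝ (V x)] [∀ x, IsScalarTower ℝ 𝕜 (V x)]
  [FiberBundle F V] [VectorBundle 𝕜 F V] [VectorBundle ℝ F V]

/-- `Γ(V)`: the `𝕜`-vector space of smooth sections. -/
def smoothSections : Submodule 𝕜 (∀ x, V x) where
  carrier := {σ | ContMDiff I (I.prod 𝓘(ℝ, F)) ∞ fun x => TotalSpace.mk' F x (σ x)}
  zero_mem' := contMDiff_zeroSection ℝ V
  add_mem' hσ hτ := hσ.add_section hτ
  smul_mem' c σ hσ x₀ := by
    have h := hσ x₀
    rw [contMDiffAt_section] at h ⊢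
    refine (((c • ContinuousLinearMap.id ℝ F).contMDiff).contMDiffAt.comp x₀ h).congr_of_eventuallyEq ?_
    filter_upwards [(trivializationAt F V x₀).open_baseSet.mem_nhds
      (mem_baseSet_trivializationAt F V x₀)] with x hx
    exact ((trivializationAt F V x₀).linear 𝕜 hx).map_smul c (σ x)

variable {V}

/-- The section `σ` in the chart and the local trivialization at `x₀`. -/
def coordRep (x₀ : M) (σ : ∀ x, V x) (u : EuclideanSpace ℝ (Fin m)) : F :=
  (trivializationAt F V x₀ ⟨(extChartAt I x₀).symm u, σ ((extChartAt I x₀).symm u)⟩).2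

variable (V) in
/-- The part of the range of the chart at `x₀` above which the trivialization at `x₀` is defined. -/
def coordDomain (x₀ : M) : Set (EuclideanSpace ℝ (Fin m)) :=
  (extChartAt I x₀).target ∩ (extChartAt I x₀).symm ⁻¹' (trivializationAt F V x₀).baseSet

variable {𝕜 I F}

/-- `D` is a differential operator (of some finite order `d`) with smooth coefficients: locally
`D = ∑ A_s ∂_{s 1} ⋯ ∂_{s k}`, the sum being over `k ≤ d` and all `s : {1, …, k} → {1, …, m}`. -/
def IsDifferentialOperator (D : smoothSections 𝕜 I F V →ₗ[𝕜] smoothSections 𝕜 I F V) : Prop :=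
  ∃ d : ℕ, ∀ x₀ : M,
    ∃ A : (k : ℕ) → (Fin k → Fin m) → EuclideanSpace ℝ (Fin m) → (F →L[𝕜] F),
      (∀ k s, ContDiffOn ℝ ∞ (A k s) (coordDomain I F V x₀)) ∧
      ∀ η : smoothSections 𝕜 I F V, ∀ u ∈ coordDomain I F V x₀,
        coordRep I F x₀ (D η).1 u = ∑ k ∈ Finset.range (d + 1), ∑ s : Fin k → Fin m,
          A k s u (iteratedFDerivWithin ℝ k (coordRep I F x₀ η.1) (range I) u
            fun j => EuclideanSpace.single (s j) 1)

variable (𝕜 I F V) in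
/-- A smooth `𝕜`-linear connection on the bundle `V`; `∇ σ x v` is `∇_v σ` at `x`. -/
structure LinearConnection [IsManifold I 1 M] where
  /-- the covariant derivative -/
  cov : CovariantDerivative I F V
  cov_smul : ∀ (c : 𝕜) (σ : ∀ x, V x) (x : M),
    MDifferentiableAt I (I.prod 𝓘(ℝ, F)) (fun y => TotalSpace.mk' F y (σ y)) x →
    ∀ v : TangentSpace I x, cov (c • σ) x v = c • cov σ x v
  smooth : CovariantDerivative.ContMDiffCovariantDerivative cov ∞

variable [RiemannianBundle (fun x : M ↦ TangentSpace I x)]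

variable (I) in
/-- `n` is the inward pointing unit normal at the boundary point `x`. The tangent space at `x` is
identified with the model space through the chart `φ` at `x`; as the range of the model is a
half-space, `v` is tangent to the boundary if `φ x + v` lies in the frontier of the half-space,
and points inwards if `φ x + v` lies in its interior. -/
def IsInwardUnitNormal (x : M) (n : TangentSpace I x) : Prop :=
  ‖n‖ = 1 ∧
  (∀ v : EuclideanSpace ℝ (Fin m), extChartAt I x x + v ∈ frontier (range I) →
    inner ℝ n (show TangentSpace I x from v) = 0) ∧
  extChartAt I x x + (show EuclideanSpace ℝ (Fin m) from n) ∈ interior (range I)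

/-- The domain `D(D)`: compactly supported smooth sections `η` with `a ∇_n η + b η = 0` on the
boundary, `n` being the inward pointing unit normal (no condition if the boundary is empty). -/
def boundaryDomain [IsManifold I ∞ M] [ContMDiffVectorBundle ∞ F V I] (nabla : LinearConnection 𝕜 I F V)
    (a b : I.boundary M → 𝕜) : Submodule 𝕜 (smoothSections 𝕜 I F V) where
  carrier := {η | IsCompact (closure {x | η.1 x ≠ 0}) ∧
    ∀ (x : I.boundary M) (n : TangentSpace I x.1), IsInwardUnitNormal I x.1 n →
      a x • nabla.cov η.1 x.1 n + b x • η.1 x.1 = 0}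
  zero_mem' := by
    refine ⟨by simp, fun x n _ => ?_⟩
    have : nabla.cov (0 : ∀ x, V x) x.1 = 0 := nabla.cov.isCovariantDerivativeOnUniv.zero
    simp [this]
  add_mem' := by
    rintro η θ ⟨hη, hη'⟩ ⟨hθ, hθ'⟩
    refine ⟨(hη.union hθ).of_isClosed_subset isClosed_closure ?_, fun x n hn => ?_⟩
    · rw [← closure_union]
      refine closure_mono fun x hx => ?_
      by_contra h
      simp only [mem_union, mem_ofPred_eq, not_or, not_not] at h
      exact hx (by simp [h.1, h.2])
    · have h := nabla.cov.isCovariantDerivativeOnUniv.add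
        ((η.2 x.1).mdifferentiableAt (by simp)) ((θ.2 x.1).mdifferentiableAt (by simp))
      have h1 := hη' x n hn
      have h2 := hθ' x n hn
      have h3 : nabla.cov (η + θ).1 x.1 n = nabla.cov η.1 x.1 n + nabla.cov θ.1 x.1 n := by
        change nabla.cov (η.1 + θ.1) x.1 n = _
        rw [h]; rfl
      have h4 : (η + θ).1 x.1 = η.1 x.1 + θ.1 x.1 := rfl
      rw [h3, h4, smul_add, smul_add, add_add_add_comm, h1, h2, add_zero]
  smul_mem' := by
    rintro c η ⟨hη, hη'⟩
    refine ⟨hη.of_isClosed_subset isClosed_closure (closure_mono fun x hx h => hx ?_),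
      fun x n hn => ?_⟩
    · change c • η.1 x = 0
      rw [h, smul_zero]
    · have h3 : nabla.cov (c • η).1 x.1 n = c • nabla.cov η.1 x.1 n :=
        nabla.cov_smul c η.1 x.1 ((η.2 x.1).mdifferentiableAt (by simp)) n
      have h4 : (c • η).1 x.1 = c • η.1 x.1 := rfl
      rw [h3, h4, smul_comm (a x) c, smul_comm (b x) c, ← smul_add, hη' x n hn, smul_zero]

/-- The differential operator `D`, with domain the sections in `boundaryDomain`, as an unbounded
operator in `L²(V)`: the operator whose graph consists of the pairs of classes of `η` and `D η`.
(Both sections are continuous with compact support, hence square integrable.) -/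
def l2Operator [SecondCountableTopology M] [Nonempty M] [MeasurableSpace M] [BorelSpace M]
    [FiniteDimensional 𝕜 F]
    [IsManifold I ∞ M] [ContMDiffVectorBundle ∞ F V I] [IsSmoothFiberMetric 𝕜 I F V]
    (nabla : LinearConnection 𝕜 I F V) (a b : I.boundary M → 𝕜)
    (D : smoothSections 𝕜 I F V →ₗ[𝕜] smoothSections 𝕜 I F V) :
    L2Section 𝕜 I F V (riemannianVolume I M) →ₗ.[𝕜] L2Section 𝕜 I F V (riemannianVolume I M) :=
  Submodule.toLinearPMap
    { carrier := {p | ∃ η ∈ boundaryDomain nabla a b,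
        ∃ (hη : η.1 ∈ sqIntegrableSections 𝕜 I F V (riemannianVolume I M))
          (hD : (D η).1 ∈ sqIntegrableSections 𝕜 I F V (riemannianVolume I M)),
          p = (L2Section.mk η.1 hη, L2Section.mk (D η).1 hD)}
      zero_mem' := by
        refine ⟨0, zero_mem _, zero_mem _, ?_, ?_⟩
        · rw [map_zero]; exact zero_mem _
        · simp only [map_zero]; rfl
      add_mem' := by
        rintro p q ⟨η, hη, h1, h2, rfl⟩ ⟨θ, hθ, h3, h4, rfl⟩
        refine ⟨η + θ, add_mem hη hθ, add_mem h1 h3, ?_, ?_⟩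
        · rw [map_add]; exact add_mem h2 h4
        · simp only [map_add]; rfl
      smul_mem' := by
        rintro c p ⟨η, hη, h1, h2, rfl⟩
        refine ⟨c • η, Submodule.smul_mem _ c hη, Submodule.smul_mem _ c h1, ?_, ?_⟩
        · rw [map_smul]; exact Submodule.smul_mem _ c h2
        · simp only [map_smul]; rfl }

variable (𝕜 I F V) in
/-- An automorphism of `V` preserving the fibre metric and covering an isometry of `M`. (For a
group of such automorphisms, smoothness of the inverses is automatic.) -/
structure BundleIsometry where
  /-- the induced diffeomorphism of `M` -/
  base : M ≃ₘ^∞⟮I, I⟯ M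
  norm_mfderiv : ∀ (x : M) (v : TangentSpace I x), ‖mfderiv I I base x v‖ = ‖v‖
  /-- the isometric isomorphisms between the fibres -/
  fiber : ∀ x : M, V x ≃ₗᵢ[𝕜] V (base x)
  smooth : ContMDiff (I.prod 𝓘(ℝ, F)) (I.prod 𝓘(ℝ, F)) ∞
    fun p : TotalSpace F V => TotalSpace.mk' F (base p.1) (fiber p.1 p.2)

namespace BundleIsometry

/-- The action of an automorphism on the total space. -/
def total (g : BundleIsometry 𝕜 I F V) (p : TotalSpace F V) : TotalSpace F V :=
  TotalSpace.mk' F (g.base p.1) (g.fiber p.1 p.2)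

/-- The push-forward `(g_* σ)(y) = g (σ (g⁻¹ y))` of a section. -/
def pushFun (g : BundleIsometry 𝕜 I F V) (σ : ∀ x, V x) (y : M) : V y :=
  (g.base.apply_symm_apply y) ▸ g.fiber (g.base.symm y) (σ (g.base.symm y))

theorem mk_pushFun (g : BundleIsometry 𝕜 I F V) (σ : ∀ x, V x) (y : M) :
    TotalSpace.mk' F y (g.pushFun σ y) =
      g.total (TotalSpace.mk' F (g.base.symm y) (σ (g.base.symm y))) := by
  have key : ∀ (z : M) (h : z = y) (w : V z), TotalSpace.mk' F y (h ▸ w) = TotalSpace.mk' F z w := by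
    rintro z rfl w; rfl
  exact key _ _ _

/-- The push-forward of a smooth section. -/
def push (g : BundleIsometry 𝕜 I F V) (σ : smoothSections 𝕜 I F V) : smoothSections 𝕜 I F V :=
  ⟨g.pushFun σ.1, by
    change ContMDiff _ _ _ _
    simp only [mk_pushFun]
    exact g.smooth.comp (σ.2.comp g.base.symm.contMDiff)⟩

end BundleIsometry

/-- The connection is preserved by `g` at the boundary points:
`∇_{dg v} (g_* σ) = g (∇_v σ)` for all smooth sections `σ` and all `v ∈ T_x M`, `x ∈ ∂M`. -/
def LinearConnection.IsInvariantAlongBoundary [IsManifold I ∞ M]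
    (nabla : LinearConnection 𝕜 I F V) (g : BundleIsometry 𝕜 I F V) : Prop :=
  ∀ (σ : smoothSections 𝕜 I F V), ∀ x ∈ I.boundary M, ∀ v : TangentSpace I x,
    nabla.cov (g.push σ).1 (g.base x) (mfderiv I I g.base x v) = g.fiber x (nabla.cov σ.1 x v)

end Operators

end

/-!
The push-forward of sections by the elements of `Γ` is a unitary representation of `Γ` on `L²(V)`:
an automorphism acts isometrically on the fibres, and the induced isometry of the base preserves
the Riemannian volume (`measurePreserving_riemannianVolume`), because in charts the density
`√(det g_ij)` picks up exactly the Jacobian determinant of the change of variables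
(`chartDensity_eq_abs_det_mul`).

The representation preserves the domain of the operator: the differential of an isometry pulls the
inward unit normal back to the inward unit normal (`isInwardUnitNormal_of_mfderiv`), so that the boundary
condition is invariant. Hence it commutes with the operator (`commutesWith_l2Operator`), therefore
also with its adjoint and, since it preserves the quadratic form, with the Friedrichs extension `A`
(`LinearPMap.CommutesWith.friedrichs`).

As `Γ` moves every compact set off itself and the sections with compact support are dense, a
finite-dimensional invariant subspace of `L²(V)` vanishes (`eq_bot_of_invariant_pushRep`): by
compactness of its unit sphere, all of its unit vectors are concentrated, up to a small error, on
one compact set `K`. If `g` moves `K` off itself and `v` is such a unit vector, then `g v` is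
concentrated on `g K`, and also on `K`, being itself a unit vector of the subspace; this is
impossible as `g K` and `K` are disjoint.

If `A - z` has finite-dimensional kernel, then this kernel is an invariant subspace and hence zero.
If moreover `A - z` has closed range of finite codimension, then the orthogonal complement of the
range is an invariant subspace and hence zero as well, so `A - z` is bijective.
-/

/-! ### Unbounded operators commuting with a unitary representation -/

namespace LinearPMap

variable {𝕜 H : Type*} [RCLike 𝕜] [NormedAddCommGroup H] [InnerProductSpace 𝕜 H]

/-- The unitary `U` maps the domain of `A` to itself and commutes with `A` there, i.e. the graph of
`A` is invariant under `U × U`. -/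
def CommutesWith (A : H →ₗ.[𝕜] H) (U : H ≃ₗᵢ[𝕜] H) : Prop :=
  ∀ v : A.domain, ∃ h : U v ∈ A.domain, A ⟨U v, h⟩ = U (A v)

theorem commutesWith_toLinearPMap {G : Submodule 𝕜 (H × H)} {U : H ≃ₗᵢ[𝕜] H}
    (h : ∀ p ∈ G, (U p.1, U p.2) ∈ G) : G.toLinearPMap.CommutesWith U := by
  rintro ⟨v, hv⟩
  obtain ⟨p, hp, rfl⟩ := hv
  refine ⟨⟨_, h p hp, rfl⟩, ?_⟩
  by_cases hG : ∀ x ∈ G, x.1 = 0 → x.2 = 0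
  · have key : ∀ q ∈ G, ∀ hq : q.1 ∈ G.toLinearPMap.domain, G.toLinearPMap ⟨q.1, hq⟩ = q.2 := by
      intro q hq hq'
      have h1 := G.sub_mem (Submodule.mem_graph_toLinearPMap hG ⟨q.1, hq'⟩) hq
      exact sub_eq_zero.1 (hG _ h1 (sub_self _))
    exact (key _ (h p hp) _).trans (congrArg U (key p hp _).symm)
  · -- if `G` is not a graph, then `G.toLinearPMap` is zero on its domain
    have key : ∀ x, G.toLinearPMap x = 0 := by
      intro x
      classical
      change (if hg : _ then G.toLinearPMapAux hg else 0) x = _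
      rw [dif_neg hG]
      rfl
    rw [key, key, _root_.map_zero]

theorem CommutesWith.quadForm_eq {A : H →ₗ.[𝕜] H} {U : H ≃ₗᵢ[𝕜] H} (h : A.CommutesWith U)
    (v : A.domain) : A.quadForm ⟨U v, (h v).1⟩ = A.quadForm v := by
  unfold quadForm
  rw [(h v).2, LinearIsometryEquiv.inner_map_map]

theorem CommutesWith.map_mem_formDomain {A : H →ₗ.[𝕜] H} {U : H ≃ₗᵢ[𝕜] H} (h : A.CommutesWith U)
    (hA : A.IsBoundedFromBelow) {v : H} (hv : v ∈ A.formDomain hA) : U v ∈ A.formDomain hA := by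
  obtain ⟨u, hu, hq⟩ := hv
  refine ⟨fun k => ⟨U (u k), (h (u k)).1⟩, (U.continuous.tendsto v).comp hu, ?_⟩
  refine hq.congr fun p => ?_
  rw [← h.quadForm_eq]
  congr 1
  exact Subtype.ext (_root_.map_sub U _ _)

/-- By `⟪U y, A x⟫ = ⟪y, A U⁻¹ x⟫`, an operator commuting with `U⁻¹` has an adjoint commuting with
`U`. -/
theorem CommutesWith.adjoint [CompleteSpace H] {A : H →ₗ.[𝕜] H} {U : H ≃ₗᵢ[𝕜] H}
    (hU : A.CommutesWith U.symm) : A.adjoint.CommutesWith U := by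
  have hinner : ∀ (y : H) (x : A.domain),
      inner 𝕜 (U y) (A x) = inner 𝕜 y (A ⟨U.symm x, (hU x).1⟩) := by
    intro y x
    rw [(hU x).2, ← U.inner_map_map y, U.apply_symm_apply]
  intro y
  have hy : U y ∈ A.adjoint.domain := by
    have h1 := (A.mem_adjoint_domain_iff y).1 y.2
    rw [mem_adjoint_domain_iff]
    have h2 : Continuous fun x : A.domain => (⟨U.symm x, (hU x).1⟩ : A.domain) :=
      (U.symm.continuous.comp continuous_subtype_val).subtype_mk _
    exact (h1.comp h2).congr fun x => (hinner y x).symm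
  refine ⟨hy, ?_⟩
  by_cases hd : Dense (A.domain : Set H)
  · refine adjoint_apply_eq hd _ fun x => ?_
    have h1 := adjoint_isFormalAdjoint hd y ⟨U.symm x, (hU x).1⟩
    change _ = inner 𝕜 (U y) (A x)
    rw [hinner, ← h1, ← U.inner_map_map (A.adjoint y) (U.symm x), U.apply_symm_apply]
  · -- without a dense domain, the adjoint is zero by convention
    rw [adjoint_apply_of_not_dense hd, adjoint_apply_of_not_dense hd, _root_.map_zero]

theorem CommutesWith.friedrichs [CompleteSpace H] {A : H →ₗ.[𝕜] H} {U : H ≃ₗᵢ[𝕜] H}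
    (hU : A.CommutesWith U) (hU' : A.CommutesWith U.symm) (hA : A.IsBoundedFromBelow) :
    (A.friedrichs hA).CommutesWith U := by
  rintro ⟨v, hv⟩
  obtain ⟨h1, h2⟩ := hU'.adjoint ⟨v, hv.2⟩
  exact ⟨⟨hU.map_mem_formDomain hA hv.1, h1⟩, h2⟩

theorem CommutesWith.subScalar_apply {A : H →ₗ.[𝕜] H} {U : H ≃ₗᵢ[𝕜] H} (h : A.CommutesWith U)
    (z : 𝕜) (v : A.domain) : A.subScalar z ⟨U v, (h v).1⟩ = U (A.subScalar z v) := by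
  change A ⟨U v, (h v).1⟩ - z • U v = U (A v - z • (v : H))
  rw [(h v).2, _root_.map_sub, _root_.map_smul]

variable {Γ : Type*} [Group Γ] {τ : Γ →* (H ≃ₗᵢ[𝕜] H)} {A : H →ₗ.[𝕜] H}

/-- The eigenspace for `z` is invariant under `τ`, so if it is finite dimensional it vanishes. -/
theorem ker_subScalar_eq_bot (hA : ∀ g, A.CommutesWith (τ g))
    (hτ : ∀ E : Submodule 𝕜 H, FiniteDimensional 𝕜 E → (∀ g, ∀ v ∈ E, τ g v ∈ E) → E = ⊥) (z : 𝕜)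
    (hz : FiniteDimensional 𝕜 (LinearMap.ker (A.subScalar z))) :
    LinearMap.ker (A.subScalar z) = ⊥ := by
  have h := hτ ((LinearMap.ker (A.subScalar z)).map A.domain.subtype) inferInstance (by
    rintro g _ ⟨v, hv, rfl⟩
    refine ⟨⟨τ g v, (hA g v).1⟩, ?_, rfl⟩
    have hv' : A.subScalar z v = 0 := hv
    change A.subScalar z _ = 0
    rw [(hA g).subScalar_apply, hv', _root_.map_zero])
  rw [← Submodule.map_bot A.domain.subtype] at h
  exact Submodule.map_injective_of_injective A.domain.subtype_injective h

/-- The orthogonal complement of the range of `A - z` is invariant under `τ`, so if the range is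
closed and of finite codimension, then it is everything. -/
theorem range_subScalar_eq_top [CompleteSpace H] (hA : ∀ g, A.CommutesWith (τ g))
    (hτ : ∀ E : Submodule 𝕜 H, FiniteDimensional 𝕜 E → (∀ g, ∀ v ∈ E, τ g v ∈ E) → E = ⊥) (z : 𝕜)
    (hc : _root_.IsClosed (LinearMap.range (A.subScalar z) : Set H))
    (hz : FiniteDimensional 𝕜 (H ⧸ LinearMap.range (A.subScalar z))) :
    LinearMap.range (A.subScalar z) = ⊤ := by
  set R := LinearMap.range (A.subScalar z) with hR
  have := hc.completeSpace_coe
  rw [← Submodule.orthogonal_eq_bot_iff]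
  refine hτ _ ?_ ?_
  · refine FiniteDimensional.of_injective (R.mkQ ∘ₗ Rᗮ.subtype) ?_
    rw [← LinearMap.ker_eq_bot, LinearMap.ker_eq_bot']
    intro v hv
    have h1 : (v : H) ∈ R := (Submodule.Quotient.mk_eq_zero R).1 hv
    exact Subtype.ext (inner_self_eq_zero.1 (Submodule.inner_right_of_mem_orthogonal h1 v.2))
  · intro g w hw
    rw [Submodule.mem_orthogonal] at hw ⊢
    rintro _ ⟨v, rfl⟩
    have h1 := hw _ ⟨⟨τ g⁻¹ v, (hA g⁻¹ v).1⟩, rfl⟩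
    rw [(hA g⁻¹).subScalar_apply, ← (τ g).inner_map_map] at h1
    have h2 : τ g (τ g⁻¹ (A.subScalar z v)) = A.subScalar z v := by
      rw [map_inv]
      exact (τ g).apply_symm_apply _
    rwa [h2] at h1

theorem spectrumSet_eq_essentialSpectrum [CompleteSpace H] (hA : ∀ g, A.CommutesWith (τ g))
    (hτ : ∀ E : Submodule 𝕜 H, FiniteDimensional 𝕜 E → (∀ g, ∀ v ∈ E, τ g v ∈ E) → E = ⊥) :
    A.spectrumSet = A.essentialSpectrum := by
  ext z
  refine not_congr ⟨fun h => ?_, fun ⟨h1, h2, h3⟩ => ?_⟩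
  · have h1 : LinearMap.ker (A.subScalar z) = ⊥ := LinearMap.ker_eq_bot.2 h.1
    have h2 : LinearMap.range (A.subScalar z) = ⊤ := LinearMap.range_eq_top.2 h.2
    rw [h1, h2]
    refine ⟨inferInstance, by simp, ?_⟩
    have : Subsingleton (H ⧸ (⊤ : Submodule 𝕜 H)) := Submodule.Quotient.subsingleton_iff.2 rfl
    infer_instance
  · exact ⟨LinearMap.ker_eq_bot.1 (ker_subScalar_eq_bot hA hτ z h1),
      LinearMap.range_eq_top.1 (range_subScalar_eq_top hA hτ z h2 h3)⟩

theorem not_hasFiniteMultiplicity (hA : ∀ g, A.CommutesWith (τ g))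
    (hτ : ∀ E : Submodule 𝕜 H, FiniteDimensional 𝕜 E → (∀ g, ∀ v ∈ E, τ g v ∈ E) → E = ⊥) {z : 𝕜}
    (hz : A.IsEigenvalue z) : ¬ A.HasFiniteMultiplicity z := by
  intro hfin
  obtain ⟨v, hv, hv'⟩ := hz
  refine hv ((Submodule.mem_bot 𝕜).1 ?_)
  rw [← ker_subScalar_eq_bot hA hτ z hfin]
  change A v - z • (v : H) = 0
  rw [hv', sub_self]

end LinearPMap

/-- A unitary representation of `Γ` has no nonzero finite-dimensional invariant subspace if the
space is the closure of a directed union of sets `S i` such that for each `i` some `g` makes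
`g • S i` orthogonal to `S i`. The unit sphere of such a subspace would be compact, hence close to a
single `S i`; for a unit vector `v` of the subspace, `v` and `g • v` would then both be close to
`S i`, which makes `⟪g • v, g • v⟫ = 1` close to an inner product of an element of `g • S i` with one
of `S i`, that is, to zero. -/
theorem eq_bot_of_invariant_of_directed {𝕜 H Γ ι : Type*} [RCLike 𝕜] [NormedAddCommGroup H]
    [InnerProductSpace 𝕜 H] [Group Γ] {τ : Γ →* (H ≃ₗᵢ[𝕜] H)} [Nonempty ι] {S : ι → Set H}
    (hdir : Directed (· ⊆ ·) S) (hdense : Dense (⋃ i, S i))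
    (hS : ∀ i, ∃ g, ∀ v ∈ S i, ∀ w ∈ S i, inner 𝕜 (τ g v) w = 0)
    (E : Submodule 𝕜 H) (hE : FiniteDimensional 𝕜 E) (hinv : ∀ g, ∀ v ∈ E, τ g v ∈ E) : E = ⊥ := by
  by_contra hne
  obtain ⟨v, hvE, hv⟩ := Submodule.exists_mem_ne_zero_of_ne_bot hne
  have hproper : ProperSpace E := FiniteDimensional.proper 𝕜 E
  have hcpt : IsCompact (Subtype.val '' Metric.sphere (0 : E) 1) :=
    (isCompact_sphere (0 : E) 1).image continuous_subtype_val
  obtain ⟨i, hi⟩ := hcpt.elim_directed_cover (fun i => Metric.thickening (1 / 3) (S i))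
    (fun i => Metric.isOpen_thickening) (by
      intro w _
      rw [← Metric.thickening_iUnion]
      exact Metric.closure_subset_thickening (by norm_num) _ (hdense w)) (fun i j => by
      obtain ⟨k, hk⟩ := hdir i j
      exact ⟨k, Metric.thickening_subset_of_subset _ hk.1,
        Metric.thickening_subset_of_subset _ hk.2⟩)
  have happrox : ∀ w ∈ E, ‖w‖ = 1 → ∃ s ∈ S i, ‖w - s‖ < 1 / 3 := by
    intro w hw hw1
    obtain ⟨s, hs, hd⟩ := Metric.mem_thickening_iff.1
      (hi ⟨⟨w, hw⟩, by simpa using hw1, rfl⟩)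
    exact ⟨s, hs, by rwa [dist_eq_norm] at hd⟩
  obtain ⟨g, hg⟩ := hS i
  set w : H := ((‖v‖⁻¹ : ℝ) : 𝕜) • v with hw
  have hwE : w ∈ E := E.smul_mem _ hvE
  have hw1 : ‖w‖ = 1 := by
    rw [hw, norm_smul, RCLike.norm_ofReal, abs_of_nonneg (by positivity),
      inv_mul_cancel₀ (norm_ne_zero_iff.2 hv)]
  have hgw1 : ‖τ g w‖ = 1 := by rw [LinearIsometryEquiv.norm_map, hw1]
  obtain ⟨s, hs, hsd⟩ := happrox w hwE hw1
  obtain ⟨t, ht, htd⟩ := happrox (τ g w) (hinv g w hwE) hgw1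
  have e : inner 𝕜 (τ g w) (τ g w) =
      inner 𝕜 (τ g (w - s)) (τ g w) + inner 𝕜 (τ g s) (τ g w - t) := by
    rw [inner_sub_right, hg s hs t ht, sub_zero, _root_.map_sub, inner_sub_left, sub_add_cancel]
  have h1 : ‖inner 𝕜 (τ g (w - s)) (τ g w)‖ ≤ 1 / 3 := by
    refine (norm_inner_le_norm _ _).trans ?_
    rw [hgw1, mul_one, LinearIsometryEquiv.norm_map]
    exact hsd.le
  have hsn : ‖s‖ ≤ 4 / 3 := by
    have := norm_sub_le w (w - s)
    rw [sub_sub_cancel] at this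
    linarith
  have h2 : ‖inner 𝕜 (τ g s) (τ g w - t)‖ ≤ 4 / 3 * (1 / 3) := by
    refine (norm_inner_le_norm _ _).trans ?_
    rw [LinearIsometryEquiv.norm_map]
    exact mul_le_mul hsn htd.le (norm_nonneg _) (by norm_num)
  have h3 : ‖inner 𝕜 (τ g w) (τ g w)‖ = 1 := by
    rw [inner_self_eq_norm_sq_to_K, hgw1]
    simp
  rw [e] at h3
  have := norm_add_le (inner 𝕜 (τ g (w - s)) (τ g w)) (inner 𝕜 (τ g s) (τ g w - t))
  linarith

/-! ### Invariance of the Riemannian volume under isometries -/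

section VolumeInvariance

variable {m : ℕ} {H : Type*} [TopologicalSpace H]
  {I : ModelWithCorners ℝ (EuclideanSpace ℝ (Fin m)) H}
  {M : Type*} [TopologicalSpace M] [ChartedSpace H M]

theorem ContinuousOn.measurableSet_inter_preimage {X Y : Type*} [TopologicalSpace X]
    [MeasurableSpace X] [BorelSpace X] [TopologicalSpace Y] [MeasurableSpace Y] [BorelSpace Y]
    {f : X → Y} {s : Set X} {t : Set Y} (hf : ContinuousOn f s) (hs : MeasurableSet s)
    (ht : MeasurableSet t) : MeasurableSet (s ∩ f ⁻¹' t) := by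
  rw [← Subtype.image_preimage_coe]
  exact hs.subtype_image ((continuousOn_iff_continuous_domRestrict.1 hf).measurable ht)

theorem measurableSet_extChartAt_target (x₀ : M) : MeasurableSet (extChartAt I x₀).target := by
  rw [extChartAt_target]
  exact (I.continuous_symm.isOpen_preimage _ (chartAt H x₀).open_target).measurableSet.inter
    I.isClosed_range.measurableSet

/-- The Gram determinant of `L e₁, …, L eₘ` is `(det L)²` times that of `e₁, …, eₘ`. -/
theorem det_gram_map (B : LinearMap.BilinForm ℝ (EuclideanSpace ℝ (Fin m)))
    (L : EuclideanSpace ℝ (Fin m) →ₗ[ℝ] EuclideanSpace ℝ (Fin m)) :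
    Matrix.det (Matrix.of fun i j =>
      B (L (EuclideanSpace.single i 1)) (L (EuclideanSpace.single j 1))) =
    LinearMap.det L ^ 2 * Matrix.det (Matrix.of fun i j =>
      B (EuclideanSpace.single i 1) (EuclideanSpace.single j 1)) := by
  let e := (EuclideanSpace.basisFun (Fin m) ℝ).toBasis
  have h := LinearMap.BilinForm.toMatrix_comp e e B L L
  have h1 : (Matrix.of fun i j => B (EuclideanSpace.single i 1) (EuclideanSpace.single j 1)) =
      LinearMap.BilinForm.toMatrix e B := by
    ext i j; simp [LinearMap.BilinForm.toMatrix_apply, e]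
  have h2 : (Matrix.of fun i j =>
      B (L (EuclideanSpace.single i 1)) (L (EuclideanSpace.single j 1))) =
      LinearMap.BilinForm.toMatrix e (B.comp L L) := by
    ext i j; simp [LinearMap.BilinForm.toMatrix_apply, e]
  rw [h1, h2, h, Matrix.det_mul, Matrix.det_mul, Matrix.det_transpose, LinearMap.det_toMatrix]
  ring

variable [RiemannianBundle (fun x : M ↦ TangentSpace I x)]

variable (I) in
/-- The Riemannian metric at `x`, as a bilinear form on the model space with which `T_x M` is
identified. -/
noncomputable def metricForm (x : M) : LinearMap.BilinForm ℝ (EuclideanSpace ℝ (Fin m)) :=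
  (innerₗ (TangentSpace I x) : TangentSpace I x →ₗ[ℝ] TangentSpace I x →ₗ[ℝ] ℝ)

theorem inner_map_map_of_norm {x y : M} (L : TangentSpace I x →L[ℝ] TangentSpace I y)
    (h : ∀ v, ‖L v‖ = ‖v‖) (v w : TangentSpace I x) : inner ℝ (L v) (L w) = inner ℝ v w := by
  rw [real_inner_eq_norm_add_mul_self_sub_norm_mul_self_sub_norm_mul_self_div_two,
    real_inner_eq_norm_add_mul_self_sub_norm_mul_self_sub_norm_mul_self_div_two v w, ← map_add,
    h, h, h]

section
variable [IsManifold I ∞ M] (φ : M ≃ₘ^∞⟮I, I⟯ M)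

/-- The map `φ` in the charts at `x₀` and `y₀`. -/
noncomputable def inCharts (x₀ y₀ : M) : EuclideanSpace ℝ (Fin m) → EuclideanSpace ℝ (Fin m) :=
  extChartAt I y₀ ∘ φ ∘ (extChartAt I x₀).symm

variable {φ} {x₀ y₀ : M} {u : EuclideanSpace ℝ (Fin m)}

theorem mdifferentiableWithinAt_inCharts (hu : u ∈ (extChartAt I x₀).target)
    (hφ : φ ((extChartAt I x₀).symm u) ∈ (extChartAt I y₀).source) :
    MDifferentiableWithinAt 𝓘(ℝ, EuclideanSpace ℝ (Fin m)) 𝓘(ℝ, EuclideanSpace ℝ (Fin m))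
      (inCharts φ x₀ y₀) (range I) u := by
  have : IsManifold I 1 M := .of_le (n := ∞) (by simp)
  rw [extChartAt_source] at hφ
  exact (mdifferentiableAt_extChartAt hφ).comp_mdifferentiableWithinAt u
    (((φ.contMDiff.mdifferentiable (by simp)) _).comp_mdifferentiableWithinAt u
      (mdifferentiableWithinAt_extChartAt_symm hu))

theorem mfderivWithin_symm_inCharts (hu : u ∈ (extChartAt I x₀).target)
    (hφ : φ ((extChartAt I x₀).symm u) ∈ (extChartAt I y₀).source)
    (v : EuclideanSpace ℝ (Fin m)) :
    (mfderivWithin 𝓘(ℝ, EuclideanSpace ℝ (Fin m)) I (extChartAt I y₀).symm (range I)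
        (inCharts φ x₀ y₀ u) (fderivWithin ℝ (inCharts φ x₀ y₀) (range I) u v) :
          EuclideanSpace ℝ (Fin m)) =
      mfderiv I I φ ((extChartAt I x₀).symm u)
        (mfderivWithin 𝓘(ℝ, EuclideanSpace ℝ (Fin m)) I (extChartAt I x₀).symm (range I) u v) := by
  have : IsManifold I 1 M := .of_le (n := ∞) (by simp)
  have hur : u ∈ range I := extChartAt_target_subset_range x₀ hu
  have huniq : UniqueMDiffWithinAt 𝓘(ℝ, EuclideanSpace ℝ (Fin m)) (range I) u :=
    I.uniqueMDiffOn u hur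
  have hmaps : MapsTo (inCharts φ x₀ y₀) (range I) (range I) := fun w _ => by
    simp only [inCharts, Function.comp_apply, extChartAt_coe]
    exact mem_range_self _
  have h1 : mfderivWithin 𝓘(ℝ, EuclideanSpace ℝ (Fin m)) I
      ((extChartAt I y₀).symm ∘ inCharts φ x₀ y₀) (range I) u =
      (mfderivWithin 𝓘(ℝ, EuclideanSpace ℝ (Fin m)) I (extChartAt I y₀).symm (range I)
        (inCharts φ x₀ y₀ u)).comp (mfderivWithin _ _ (inCharts φ x₀ y₀) (range I) u) :=
    mfderivWithin_comp u
      (mdifferentiableWithinAt_extChartAt_symm ((extChartAt I y₀).map_source hφ))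
      (mdifferentiableWithinAt_inCharts hu hφ) hmaps huniq
  have h2 : mfderivWithin 𝓘(ℝ, EuclideanSpace ℝ (Fin m)) I
      (φ ∘ (extChartAt I x₀).symm) (range I) u =
      (mfderiv I I φ ((extChartAt I x₀).symm u)).comp
        (mfderivWithin 𝓘(ℝ, EuclideanSpace ℝ (Fin m)) I (extChartAt I x₀).symm (range I) u) :=
    mfderiv_comp_mfderivWithin u ((φ.contMDiff.mdifferentiable (by simp)) _)
      (mdifferentiableWithinAt_extChartAt_symm hu) huniq
  have h3 : (extChartAt I y₀).symm ∘ inCharts φ x₀ y₀ =ᶠ[𝓝[range I] u]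
      φ ∘ (extChartAt I x₀).symm := by
    have hc : ContinuousWithinAt (φ ∘ (extChartAt I x₀).symm) (range I) u :=
      (φ.continuous.continuousAt).comp_continuousWithinAt
        (mdifferentiableWithinAt_extChartAt_symm hu).continuousWithinAt
    filter_upwards [hc ((isOpen_extChartAt_source y₀).mem_nhds hφ)] with w hw
    exact (extChartAt I y₀).left_inv hw
  have h4 := h3.mfderivWithin_eq ((extChartAt I y₀).left_inv hφ)
    (I := 𝓘(ℝ, EuclideanSpace ℝ (Fin m))) (I' := I)
  rw [h1, mfderivWithin_eq_fderivWithin] at h4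
  exact (DFunLike.congr_fun h4 v).trans (DFunLike.congr_fun h2 v)

/-- The density of the metric transforms with the Jacobian determinant of an isometry. -/
theorem chartDensity_eq_abs_det_mul
    (hiso : ∀ (x : M) (v : TangentSpace I x), ‖mfderiv I I φ x v‖ = ‖v‖)
    (hu : u ∈ (extChartAt I x₀).target)
    (hφ : φ ((extChartAt I x₀).symm u) ∈ (extChartAt I y₀).source) :
    chartDensity I M x₀ u = |(fderivWithin ℝ (inCharts φ x₀ y₀) (range I) u).det| *
      chartDensity I M y₀ (inCharts φ x₀ y₀ u) := by
  set Y : EuclideanSpace ℝ (Fin m) →ₗ[ℝ] EuclideanSpace ℝ (Fin m) :=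
    (mfderivWithin 𝓘(ℝ, EuclideanSpace ℝ (Fin m)) I (extChartAt I y₀).symm (range I)
      (inCharts φ x₀ y₀ u)).toLinearMap with hY
  set L := fderivWithin ℝ (inCharts φ x₀ y₀) (range I) u with hL
  have hbase : (extChartAt I y₀).symm (inCharts φ x₀ y₀ u) = φ ((extChartAt I x₀).symm u) :=
    (extChartAt I y₀).left_inv hφ
  let X (i : Fin m) : TangentSpace I ((extChartAt I x₀).symm u) :=
    mfderivWithin 𝓘(ℝ, EuclideanSpace ℝ (Fin m)) I (extChartAt I x₀).symm (range I) u
      (EuclideanSpace.single i (1 : ℝ))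
  let B := (metricForm I ((extChartAt I y₀).symm (inCharts φ x₀ y₀ u))).comp Y Y
  have h1 : chartDensity I M y₀ (inCharts φ x₀ y₀ u) = √(Matrix.det (Matrix.of fun i j =>
      B (EuclideanSpace.single i 1) (EuclideanSpace.single j 1))) := rfl
  have h2 : chartDensity I M x₀ u = √(Matrix.det (Matrix.of fun i j =>
      B (L.toLinearMap (EuclideanSpace.single i 1))
        (L.toLinearMap (EuclideanSpace.single j 1)))) := by
    change √(Matrix.det (Matrix.of fun i j => inner ℝ (X i) (X j))) = _
    congr 3
    funext i j
    have hv : ∀ i, Y (L (EuclideanSpace.single i 1)) =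
        mfderiv I I φ ((extChartAt I x₀).symm u) (X i) := fun i =>
      mfderivWithin_symm_inCharts hu hφ _
    change _ = metricForm I ((extChartAt I y₀).symm (inCharts φ x₀ y₀ u))
      (Y (L (EuclideanSpace.single i 1))) (Y (L (EuclideanSpace.single j 1)))
    rw [hv, hv, hbase]
    exact (inner_map_map_of_norm _ (hiso _) (X i) (X j)).symm
  rw [h1, h2, det_gram_map, Real.sqrt_mul (sq_nonneg _), Real.sqrt_sq_eq_abs]

variable [MeasurableSpace M] [BorelSpace M]

theorem chartVolume_apply {A : Set M} (hA : MeasurableSet A) :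
    chartVolume I M x₀ A = ∫⁻ u in (extChartAt I x₀).target ∩ (extChartAt I x₀).symm ⁻¹' A,
      ENNReal.ofReal (chartDensity I M x₀ u) := by
  have hm : AEMeasurable (extChartAt I x₀).symm (volume.restrict (extChartAt I x₀).target) :=
    (continuousOn_extChartAt_symm x₀).aemeasurable (measurableSet_extChartAt_target x₀)
  rw [chartVolume, Measure.map_apply_of_aemeasurable
    (hm.mono_ac (withDensity_absolutelyContinuous _ _)) hA, withDensity_apply',
    Measure.restrict_restrict' (measurableSet_extChartAt_target x₀), inter_comm]

theorem chartVolume_image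
    (hiso : ∀ (x : M) (v : TangentSpace I x), ‖mfderiv I I φ x v‖ = ‖v‖)
    {A : Set M} (hA : MeasurableSet A) (hAx : A ⊆ (chartAt H x₀).source)
    (hAy : φ '' A ⊆ (chartAt H y₀).source) :
    chartVolume I M y₀ (φ '' A) = chartVolume I M x₀ A := by
  rw [← extChartAt_source I] at hAx hAy
  have hAφ : MeasurableSet (φ '' A) :=
    φ.toHomeomorph.toMeasurableEquiv.measurableEmbedding.measurableSet_image.2 hA
  rw [chartVolume_apply hA, chartVolume_apply hAφ]
  set S := (extChartAt I x₀).target ∩ (extChartAt I x₀).symm ⁻¹' A with hS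
  have hSm : MeasurableSet S := (continuousOn_extChartAt_symm x₀).measurableSet_inter_preimage
    (measurableSet_extChartAt_target x₀) hA
  have hSy : ∀ u ∈ S, φ ((extChartAt I x₀).symm u) ∈ (extChartAt I y₀).source := fun u hu =>
    hAy (mem_image_of_mem φ hu.2)
  have himage : (extChartAt I y₀).target ∩ (extChartAt I y₀).symm ⁻¹' (φ '' A) =
      inCharts φ x₀ y₀ '' S := by
    ext w
    constructor
    · rintro ⟨hw, a, ha, haw⟩
      refine ⟨extChartAt I x₀ a, ⟨(extChartAt I x₀).map_source (hAx ha), ?_⟩, ?_⟩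
      · rw [mem_preimage, (extChartAt I x₀).left_inv (hAx ha)]
        exact ha
      · simp only [inCharts, Function.comp_apply]
        rw [(extChartAt I x₀).left_inv (hAx ha), haw, (extChartAt I y₀).right_inv hw]
    · rintro ⟨u, hu, rfl⟩
      refine ⟨(extChartAt I y₀).map_source (hSy u hu), ?_⟩
      simp only [inCharts, Function.comp_apply, mem_preimage]
      rw [(extChartAt I y₀).left_inv (hSy u hu)]
      exact mem_image_of_mem φ hu.2
  have hinj : InjOn (inCharts φ x₀ y₀) S := by
    intro u hu w hw h
    exact (extChartAt I x₀).symm.injOn hu.1 hw.1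
      (φ.injective ((extChartAt I y₀).injOn (hSy u hu) (hSy w hw) h))
  have hderiv : ∀ u ∈ S, HasFDerivWithinAt (inCharts φ x₀ y₀)
      (fderivWithin ℝ (inCharts φ x₀ y₀) (range I) u) S u := fun u hu =>
    ((mdifferentiableWithinAt_inCharts hu.1 (hSy u hu)).differentiableWithinAt
      |>.hasFDerivWithinAt).mono
        (inter_subset_left.trans (extChartAt_target_subset_range x₀))
  rw [himage, lintegral_image_eq_lintegral_abs_det_fderiv_mul volume hSm hderiv hinj]
  refine setLIntegral_congr_fun hSm fun u hu => ?_
  beta_reduce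
  rw [chartDensity_eq_abs_det_mul hiso hu.1 (hSy u hu), ENNReal.ofReal_mul (abs_nonneg _)]

variable [SecondCountableTopology M] [Nonempty M]

/-- On the domain of any chart, the Riemannian volume is given by `√(det g_ij) du`. -/
theorem riemannianVolume_eq_chartVolume {A : Set M} (hA : MeasurableSet A)
    (hAx : A ⊆ (chartAt H x₀).source) : riemannianVolume I M A = chartVolume I M x₀ A := by
  set c : ℕ → M := (exists_seq_chart_cover (H := H) M).choose with hc
  have hcover : ⋃ n, (chartAt H (c n)).source = univ :=
    (exists_seq_chart_cover (H := H) M).choose_spec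
  set P : ℕ → Set M := disjointed (fun k => (chartAt H (c k)).source) with hP
  have hPm : ∀ n, MeasurableSet (P n) := fun n =>
    MeasurableSet.disjointed (fun k => (chartAt H (c k)).open_source.measurableSet) n
  have hPU : ⋃ n, P n = univ := by rw [hP, iUnion_disjointed, hcover]
  have h1 : riemannianVolume I M A = ∑' n, chartVolume I M (c n) (A ∩ P n) := by
    rw [riemannianVolume, Measure.sum_apply _ hA]
    exact tsum_congr fun n => Measure.restrict_apply hA
  have h2 : ∀ n, chartVolume I M (c n) (A ∩ P n) = chartVolume I M x₀ (A ∩ P n) := by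
    intro n
    have h := chartVolume_image (φ := Diffeomorph.refl I M ∞) (x₀ := x₀) (y₀ := c n)
      (fun x v => by
        have : mfderiv I I (Diffeomorph.refl I M ∞) x = ContinuousLinearMap.id ℝ _ := mfderiv_id
        rw [this]; rfl) (hA.inter (hPm n)) (inter_subset_left.trans hAx)
      (by
        rw [Diffeomorph.coe_refl, image_id]
        exact inter_subset_right.trans (disjointed_subset _ n))
    rwa [Diffeomorph.coe_refl, image_id] at h
  rw [h1, tsum_congr h2, ← measure_iUnion, ← inter_iUnion, hPU, inter_univ]
  · exact fun i j hij => ((disjoint_disjointed _ hij).mono inter_subset_right inter_subset_right)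
  · exact fun n => hA.inter (hPm n)

/-- Isometries preserve the Riemannian volume (stated for the inverse of `φ`, through which sections
are pushed forward). -/
theorem measurePreserving_riemannianVolume
    (hiso : ∀ (x : M) (v : TangentSpace I x), ‖mfderiv I I φ x v‖ = ‖v‖) :
    MeasurePreserving φ.symm (riemannianVolume I M) (riemannianVolume I M) := by
  refine ⟨φ.symm.continuous.measurable, ?_⟩
  obtain ⟨c, hc⟩ := exists_seq_chart_cover (H := H) M
  have hcover : ⋃ p : ℕ × ℕ, (chartAt H (c p.1)).source ∩ φ ⁻¹' (chartAt H (c p.2)).source =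
      univ := by
    refine eq_univ_of_forall fun x => ?_
    obtain ⟨i, hi⟩ := mem_iUnion.1 (hc.symm ▸ mem_univ x)
    obtain ⟨j, hj⟩ := mem_iUnion.1 (hc.symm ▸ mem_univ (φ x))
    exact mem_iUnion.2 ⟨(i, j), hi, hj⟩
  refine (Measure.ext_iff_of_iUnion_eq_univ hcover).2 fun p => Measure.ext fun A hA => ?_
  have hs : MeasurableSet
      ((chartAt H (c p.1)).source ∩ φ ⁻¹' (chartAt H (c p.2)).source) :=
    (chartAt H (c p.1)).open_source.measurableSet.inter
      ((chartAt H (c p.2)).open_source.preimage φ.continuous).measurableSet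
  have hB := hA.inter hs
  rw [Measure.restrict_apply hA, Measure.restrict_apply hA,
    Measure.map_apply φ.symm.continuous.measurable hB, ← φ.toEquiv_coe_symm,
    ← φ.toEquiv.image_eq_preimage_symm, φ.coe_toEquiv]
  set B := A ∩ ((chartAt H (c p.1)).source ∩ φ ⁻¹' (chartAt H (c p.2)).source)
  have hB1 : B ⊆ (chartAt H (c p.1)).source := fun x hx => hx.2.1
  have hB2 : φ '' B ⊆ (chartAt H (c p.2)).source := image_subset_iff.2 fun x hx => hx.2.2
  have hBφ : MeasurableSet (φ '' B) :=
    φ.toHomeomorph.toMeasurableEquiv.measurableEmbedding.measurableSet_image.2 hB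
  rw [riemannianVolume_eq_chartVolume hBφ hB2, riemannianVolume_eq_chartVolume hB hB1,
    chartVolume_image hiso hB hB1 hB2]

end

end VolumeInvariance

/-! ### Square-integrable sections with compact support -/

section SupportedIn

variable {𝕜 : Type*} [RCLike 𝕜] {m : ℕ} {H : Type*} [TopologicalSpace H]
  {I : ModelWithCorners ℝ (EuclideanSpace ℝ (Fin m)) H}
  {M : Type*} [TopologicalSpace M] [ChartedSpace H M]
  {F : Type*} [NormedAddCommGroup F] [NormedSpace 𝕜 F] [NormedSpace ℝ F] [IsScalarTower ℝ 𝕜 F]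
  {V : M → Type*} [TopologicalSpace (TotalSpace F V)]
  [∀ x, NormedAddCommGroup (V x)] [∀ x, InnerProductSpace 𝕜 (V x)]
  [∀ x, NormedSpace ℝ (V x)] [∀ x, IsScalarTower ℝ 𝕜 (V x)]
  [FiberBundle F V] [VectorBundle 𝕜 F V] [VectorBundle ℝ F V]
  [FiniteDimensional 𝕜 F] [SecondCountableTopology M] [MeasurableSpace M] [BorelSpace M]
  [ContMDiffVectorBundle ∞ F V I] [IsSmoothFiberMetric 𝕜 I F V]

theorem L2Section.exists_mk_eq {μ : Measure M} (v : L2Section 𝕜 I F V μ) :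
    ∃ (σ : ∀ x, V x) (hσ : σ ∈ sqIntegrableSections 𝕜 I F V μ), L2Section.mk σ hσ = v := by
  obtain ⟨σ, rfl⟩ := SeparationQuotient.surjective_mk v
  exact ⟨σ.val, σ.mem, rfl⟩

variable (𝕜 I F V) in
/-- The classes in `L²(V)` of the square-integrable sections vanishing outside of `K`. -/
def supportedIn (μ : Measure M) (K : Set M) : Set (L2Section 𝕜 I F V μ) :=
  {v | ∃ (σ : ∀ x, V x) (hσ : σ ∈ sqIntegrableSections 𝕜 I F V μ),
    (∀ x ∉ K, σ x = 0) ∧ L2Section.mk σ hσ = v}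

theorem supportedIn_mono {μ : Measure M} {K L : Set M} (h : K ⊆ L) :
    supportedIn 𝕜 I F V μ K ⊆ supportedIn 𝕜 I F V μ L := by
  rintro _ ⟨σ, hσ, h0, rfl⟩
  exact ⟨σ, hσ, fun x hx => h0 x fun hK => hx (h hK), rfl⟩

theorem inner_eq_zero_of_supportedIn {μ : Measure M} {K L : Set M} (h : K ∩ L = ∅)
    {v w : L2Section 𝕜 I F V μ} (hv : v ∈ supportedIn 𝕜 I F V μ K)
    (hw : w ∈ supportedIn 𝕜 I F V μ L) : inner 𝕜 v w = 0 := by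
  obtain ⟨σ, hσ, hσ0, rfl⟩ := hv
  obtain ⟨τ, hτ, hτ0, rfl⟩ := hw
  change ∫ x, inner 𝕜 (σ x) (τ x) ∂μ = 0
  refine integral_eq_zero_of_ae (Eventually.of_forall fun x => ?_)
  by_cases hx : x ∈ K
  · have hL : x ∉ L := fun hL => (h ▸ ⟨hx, hL⟩ : x ∈ (∅ : Set M))
    simp [hτ0 x hL]
  · simp [hσ0 x hx]

open Classical in
theorem piecewise_mem_sqIntegrableSections {μ : Measure M} {K : Set M} (hK : MeasurableSet K)
    {σ : ∀ x, V x} (hσ : σ ∈ sqIntegrableSections 𝕜 I F V μ) :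
    K.piecewise σ 0 ∈ sqIntegrableSections 𝕜 I F V μ := by
  have hmeas : K.piecewise σ 0 ∈ measurableSections 𝕜 F V μ := by
    intro x₀
    refine ((hσ.1 x₀).indicator hK).congr ?_
    refine ae_restrict_of_forall_mem (trivializationAt F V x₀).open_baseSet.measurableSet ?_
    intro x hx
    by_cases hxK : x ∈ K
    · simp [hxK]
    · beta_reduce
      rw [indicator_of_notMem hxK, piecewise_eq_of_notMem _ _ _ hxK]
      exact (((trivializationAt F V x₀).linear 𝕜 hx).map_zero).symm
  refine ⟨hmeas, hσ.2.mono (aestronglyMeasurable_norm_section I hmeas)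
    (Eventually.of_forall fun x => ?_)⟩
  by_cases hxK : x ∈ K <;> simp [hxK]

/-- Cutting off along an exhaustion by compact sets approximates every section in `L²`. -/
theorem dense_iUnion_supportedIn [T2Space M] (μ : Measure M) :
    Dense (⋃ K : TopologicalSpace.Compacts M, supportedIn 𝕜 I F V μ (K : Set M)) := by
  classical
  have : LocallyCompactSpace M := Manifold.locallyCompact_of_finiteDimensional I
  intro v
  obtain ⟨σ, hσ, rfl⟩ := v.exists_mk_eq
  let K : CompactExhaustion M := default
  have hKm : ∀ n, MeasurableSet (K n) := fun n => (K.isCompact n).isClosed.measurableSet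
  let u : ℕ → PreL2Section 𝕜 I F V μ := fun n =>
    ⟨(K n).piecewise σ 0, piecewise_mem_sqIntegrableSections (hKm n) hσ⟩
  let s : PreL2Section 𝕜 I F V μ := ⟨σ, hσ⟩
  refine mem_closure_of_tendsto (f := fun n => (SeparationQuotient.mk (u n) : L2Section 𝕜 I F V μ))
    (b := atTop) ?_ (Eventually.of_forall fun n => mem_iUnion.2 ⟨⟨K n, K.isCompact n⟩,
      (u n).val, (u n).mem, fun x hx => piecewise_eq_of_notMem _ _ _ hx, rfl⟩)
  refine (SeparationQuotient.continuous_mk.tendsto s).comp ?_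
  rw [tendsto_iff_norm_sub_tendsto_zero]
  suffices h : Tendsto (fun n => ‖u n - s‖ ^ 2) atTop (𝓝 0) by
    have h1 := (Real.continuous_sqrt.tendsto 0).comp h
    simpa [Function.comp_def] using h1
  simp only [PreL2Section.norm_sq_eq]
  have hval : ∀ n x, ‖(u n - s).val x‖ ^ 2 = (K n)ᶜ.indicator (fun x => ‖σ x‖ ^ 2) x := by
    intro n x
    change ‖(K n).piecewise σ 0 x - σ x‖ ^ 2 = _
    by_cases hx : x ∈ K n <;> simp [hx]
  simp only [hval]
  rw [← integral_zero M ℝ (μ := μ)]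
  have hint : Integrable (fun x => ‖σ x‖ ^ 2) μ := hσ.2.integrable_sq
  refine tendsto_integral_of_dominated_convergence (fun x => ‖σ x‖ ^ 2)
    (fun n => hint.1.indicator (hKm n).compl) hint
    (fun n => Eventually.of_forall fun x => ?_) (Eventually.of_forall fun x => ?_)
  · rw [Real.norm_of_nonneg (indicator_nonneg (fun _ _ => sq_nonneg _) _)]
    exact indicator_le_self' (fun _ _ => sq_nonneg _) x
  · obtain ⟨N, hN⟩ := mem_iUnion.1 (K.iUnion_eq ▸ mem_univ x)
    refine tendsto_const_nhds.congr' ?_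
    filter_upwards [eventually_ge_atTop N] with n hn
    have hx : x ∈ K n := K.subset hn hN
    simp [hx]

end SupportedIn

/-! ### The unitary representation on square-integrable sections -/

section PushForward

variable {𝕜 : Type*} [RCLike 𝕜] {m : ℕ} {H : Type*} [TopologicalSpace H]
  {I : ModelWithCorners ℝ (EuclideanSpace ℝ (Fin m)) H}
  {M : Type*} [TopologicalSpace M] [ChartedSpace H M]
  {F : Type*} [NormedAddCommGroup F] [NormedSpace 𝕜 F] [NormedSpace ℝ F] [IsScalarTower ℝ 𝕜 F]
  {V : M → Type*} [TopologicalSpace (TotalSpace F V)]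
  [∀ x, NormedAddCommGroup (V x)] [∀ x, InnerProductSpace 𝕜 (V x)]
  [∀ x, NormedSpace ℝ (V x)] [∀ x, IsScalarTower ℝ 𝕜 (V x)]
  [FiberBundle F V] [VectorBundle 𝕜 F V] [VectorBundle ℝ F V]
  [RiemannianBundle (fun x : M ↦ TangentSpace I x)]

namespace BundleIsometry

variable (g : BundleIsometry 𝕜 I F V)

theorem base_surjective (y : M) : ∃ x, g.base x = y := ⟨_, g.base.apply_symm_apply y⟩

theorem pushFun_base (σ : ∀ x, V x) (x : M) : g.pushFun σ (g.base x) = g.fiber x (σ x) := by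
  have h := g.mk_pushFun σ (g.base x)
  rw [g.base.symm_apply_apply] at h
  exact TotalSpace.mk_injective _ h

theorem pushFun_add (σ τ : ∀ x, V x) : g.pushFun (σ + τ) = g.pushFun σ + g.pushFun τ := by
  funext y
  obtain ⟨x, rfl⟩ := g.base_surjective y
  simp only [Pi.add_apply, pushFun_base, map_add]

theorem pushFun_smul (c : 𝕜) (σ : ∀ x, V x) : g.pushFun (c • σ) = c • g.pushFun σ := by
  funext y
  obtain ⟨x, rfl⟩ := g.base_surjective y
  simp only [Pi.smul_apply, pushFun_base, map_smul]

theorem norm_pushFun (σ : ∀ x, V x) (y : M) : ‖g.pushFun σ y‖ = ‖σ (g.base.symm y)‖ := by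
  obtain ⟨x, rfl⟩ := g.base_surjective y
  rw [pushFun_base, g.base.symm_apply_apply, LinearIsometryEquiv.norm_map]

theorem pushFun_ne_zero_iff (σ : ∀ x, V x) (y : M) :
    g.pushFun σ y ≠ 0 ↔ σ (g.base.symm y) ≠ 0 := by
  rw [← norm_ne_zero_iff, norm_pushFun, norm_ne_zero_iff]

theorem base_eq_of_total {g h k : BundleIsometry 𝕜 I F V} (hk : k.total = g.total ∘ h.total)
    (x : M) : k.base x = g.base (h.base x) :=
  congrArg TotalSpace.proj (congrFun hk (TotalSpace.mk' F x 0))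

theorem pushFun_of_total {g h k : BundleIsometry 𝕜 I F V} (hk : k.total = g.total ∘ h.total)
    (σ : ∀ x, V x) : k.pushFun σ = g.pushFun (h.pushFun σ) := by
  funext y
  refine TotalSpace.mk_injective (F := F) y ?_
  have h1 : k.base.symm y = h.base.symm (g.base.symm y) := by
    refine k.base.injective ?_
    change k.base _ = k.base _
    rw [k.base.apply_symm_apply, base_eq_of_total hk, h.base.apply_symm_apply,
      g.base.apply_symm_apply]
  refine (k.mk_pushFun σ y).trans (Eq.trans ?_ (g.mk_pushFun (h.pushFun σ) y).symm)
  rw [hk, h1]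
  exact congrArg g.total (h.mk_pushFun σ (g.base.symm y)).symm

theorem pushFun_of_total_eq_id {k : BundleIsometry 𝕜 I F V} (hk : k.total = id)
    (σ : ∀ x, V x) : k.pushFun σ = σ := by
  funext y
  refine TotalSpace.mk_injective (F := F) y ?_
  have h1 : k.base.symm y = y := by
    refine k.base.injective ?_
    change k.base _ = k.base _
    rw [k.base.apply_symm_apply]
    exact (congrArg TotalSpace.proj (congrFun hk (TotalSpace.mk' F y 0))).symm
  exact (k.mk_pushFun σ y).trans (by rw [hk, h1]; rfl)

variable [FiniteDimensional 𝕜 F] [SecondCountableTopology M] [MeasurableSpace M] [BorelSpace M]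

theorem pushFun_mem_measurableSections {μ : Measure M} (hμ : MeasurePreserving g.base.symm μ μ)
    {σ : ∀ x, V x} (hσ : σ ∈ measurableSections 𝕜 F V μ) :
    g.pushFun σ ∈ measurableSections 𝕜 F V μ := by
  intro y₀
  set e' := trivializationAt F V y₀ with he'
  set B : Set M := g.base ⁻¹' e'.baseSet with hB
  have hBm : MeasurableSet B := (e'.open_baseSet.preimage g.base.continuous).measurableSet
  suffices h : AEStronglyMeasurable
      (fun x => (e' (g.total (TotalSpace.mk' F x (σ x)))).2) (μ.restrict B) by
    have h1 := h.comp_measurePreserving (hμ.restrict_preimage hBm)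
    have h2 : g.base.symm ⁻¹' B = e'.baseSet := by
      ext y
      rw [hB, mem_preimage, mem_preimage, g.base.apply_symm_apply]
    rw [h2] at h1
    refine h1.congr (Eventually.of_forall fun y => ?_)
    change (e' (g.total (TotalSpace.mk' F _ _))).2 = (e' (TotalSpace.mk' F y _)).2
    rw [mk_pushFun]
  -- in a local frame, `g σ` is a combination of the continuous sections `g fᵢ` with the
  -- measurable coefficients of `σ`
  obtain ⟨s, hs, hU⟩ := TopologicalSpace.countable_cover_nhds
    (fun x : M => (trivializationAt F V x).open_baseSet.mem_nhds
      (mem_baseSet_trivializationAt F V x))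
  have := hs.to_subtype
  rw [biUnion_eq_iUnion] at hU
  rw [← inter_univ B, ← hU, inter_iUnion, aestronglyMeasurable_iUnion_iff]
  rintro ⟨x₀, -⟩
  set e := trivializationAt F V x₀ with he
  change AEStronglyMeasurable _ (μ.restrict (B ∩ e.baseSet))
  have hBe : MeasurableSet (B ∩ e.baseSet) := hBm.inter e.open_baseSet.measurableSet
  let b := Module.finBasis 𝕜 F
  have hc : ∀ i, AEStronglyMeasurable (fun x => b.repr (e ⟨x, σ x⟩).2 i)
      (μ.restrict (B ∩ e.baseSet)) := fun i =>
    (LinearMap.continuous_of_finiteDimensional (b.coord i)).comp_aestronglyMeasurable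
      ((hσ x₀).mono_set inter_subset_right)
  have hf : ∀ i, AEStronglyMeasurable
      (fun x => (e' (g.total (TotalSpace.mk' F x (e.symm x (b i))))).2)
      (μ.restrict (B ∩ e.baseSet)) := by
    intro i
    refine ContinuousOn.aestronglyMeasurable ?_ hBe
    have h1 : ContinuousOn (fun x => TotalSpace.mk' F x (e.symm x (b i))) (B ∩ e.baseSet) :=
      e.continuousOn_symm.comp (f := fun x => (x, b i)) (by fun_prop) fun x hx => ⟨hx.2, trivial⟩
    have h2 : Continuous g.total := g.smooth.continuous
    exact continuous_snd.comp_continuousOn (e'.continuousOn.comp (h2.comp_continuousOn h1)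
      fun x hx => e'.mem_source.2 hx.1)
  refine (Finset.aestronglyMeasurable_fun_sum Finset.univ
    fun i _ => (hc i).smul (hf i)).congr ?_
  refine ae_restrict_of_forall_mem hBe fun x hx => ?_
  have hexp : σ x = ∑ i, b.repr (e ⟨x, σ x⟩).2 i • e.symm x (b i) := by
    have h1 : e.symmₗ 𝕜 x (e ⟨x, σ x⟩).2 = σ x := by
      rw [e.symmₗ_apply hx.2]
      exact e.symm_proj_apply ⟨x, σ x⟩ hx.2
    conv_lhs => rw [← h1, ← b.sum_repr (e ⟨x, σ x⟩).2]
    rw [map_sum]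
    refine Finset.sum_congr rfl fun i _ => ?_
    rw [map_smul, e.symmₗ_apply hx.2]
  have hlin : ∀ v : V x, (e' (g.total (TotalSpace.mk' F x v))).2 =
      e'.linearMapAt 𝕜 (g.base x) (g.fiber x v) := fun v => by
    rw [e'.linearMapAt_apply, if_pos (show g.base x ∈ e'.baseSet from hx.1)]
    rfl
  change ∑ i, b.repr (e ⟨x, σ x⟩).2 i • (e' (g.total (TotalSpace.mk' F x (e.symm x (b i))))).2 = _
  simp only [hlin]
  conv_rhs => rw [hexp]
  simp only [map_sum, map_smul]

variable [IsManifold I ∞ M] [ContMDiffVectorBundle ∞ F V I] [IsSmoothFiberMetric 𝕜 I F V]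
  [Nonempty M]

theorem measurePreserving_base_symm :
    MeasurePreserving g.base.symm (riemannianVolume I M) (riemannianVolume I M) :=
  measurePreserving_riemannianVolume g.norm_mfderiv

theorem pushFun_mem_sqIntegrableSections {σ : ∀ x, V x}
    (hσ : σ ∈ sqIntegrableSections 𝕜 I F V (riemannianVolume I M)) :
    g.pushFun σ ∈ sqIntegrableSections 𝕜 I F V (riemannianVolume I M) := by
  refine ⟨g.pushFun_mem_measurableSections g.measurePreserving_base_symm hσ.1, ?_⟩
  simp only [norm_pushFun]
  exact hσ.2.comp_measurePreserving g.measurePreserving_base_symm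

/-- The push-forward of square-integrable sections. -/
noncomputable def pushPreL2 : PreL2Section 𝕜 I F V (riemannianVolume I M) →ₗᵢ[𝕜]
    PreL2Section 𝕜 I F V (riemannianVolume I M) where
  toFun σ := ⟨g.pushFun σ.val, g.pushFun_mem_sqIntegrableSections σ.mem⟩
  map_add' σ τ := Subtype.ext (g.pushFun_add σ.val τ.val)
  map_smul' c σ := Subtype.ext (g.pushFun_smul c σ.val)
  norm_map' σ := by
    refine (sq_eq_sq₀ (norm_nonneg _) (norm_nonneg _)).1 ?_
    rw [PreL2Section.norm_sq_eq, PreL2Section.norm_sq_eq]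
    change ∫ y, ‖g.pushFun σ.val y‖ ^ 2 ∂(riemannianVolume I M) = _
    simp only [norm_pushFun]
    exact g.measurePreserving_base_symm.integral_comp
      g.base.symm.toHomeomorph.measurableEmbedding (fun x => ‖σ.val x‖ ^ 2)

/-- The push-forward on the Hilbert space `L²(V)`. -/
noncomputable def pushL2 : L2Section 𝕜 I F V (riemannianVolume I M) →ₗᵢ[𝕜]
    L2Section 𝕜 I F V (riemannianVolume I M) where
  toLinearMap := (SeparationQuotient.liftCLM
    ((SeparationQuotient.mkCLM 𝕜 _).comp g.pushPreL2.toContinuousLinearMap)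
    (fun x y (h : Inseparable x y) =>
      SeparationQuotient.mk_eq_mk.2 (h.map g.pushPreL2.continuous)) :
      SeparationQuotient (PreL2Section 𝕜 I F V (riemannianVolume I M)) →L[𝕜]
        SeparationQuotient (PreL2Section 𝕜 I F V (riemannianVolume I M))).toLinearMap
  norm_map' v := by
    obtain ⟨σ, rfl⟩ := SeparationQuotient.surjective_mk v
    exact (SeparationQuotient.norm_mk (g.pushPreL2 σ)).trans
      ((g.pushPreL2.norm_map σ).trans (SeparationQuotient.norm_mk σ).symm)

theorem pushL2_mk {σ : ∀ x, V x} (hσ : σ ∈ sqIntegrableSections 𝕜 I F V (riemannianVolume I M)) :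
    g.pushL2 (L2Section.mk σ hσ) =
      L2Section.mk (g.pushFun σ) (g.pushFun_mem_sqIntegrableSections hσ) := rfl

end BundleIsometry

variable [FiniteDimensional 𝕜 F] [SecondCountableTopology M] [MeasurableSpace M] [BorelSpace M]
  [IsManifold I ∞ M] [ContMDiffVectorBundle ∞ F V I] [IsSmoothFiberMetric 𝕜 I F V]
  [Nonempty M] {Γ : Type*} [Group Γ] (ρ : Γ → BundleIsometry 𝕜 I F V)
  (hρ : ∀ g h : Γ, (ρ (g * h)).total = (ρ g).total ∘ (ρ h).total)

include hρ in
theorem total_one_eq_id : (ρ 1).total = id := by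
  have h : ∀ p, (ρ 1).total p = (ρ 1).total ((ρ 1).total p) := fun p => by
    conv_lhs => rw [← mul_one (1 : Γ), hρ]
    rfl
  have hinj : Function.Injective (ρ 1).total := by
    rintro ⟨x, v⟩ ⟨y, w⟩ hxy
    obtain rfl : x = y := (ρ 1).base.injective (congrArg TotalSpace.proj hxy)
    exact congrArg _ (((ρ 1).fiber x).injective (TotalSpace.mk_injective _ hxy))
  exact funext fun p => (hinj (h p)).symm

include hρ in
theorem pushL2_mul_apply (g h : Γ) (v : L2Section 𝕜 I F V (riemannianVolume I M)) :
    (ρ (g * h)).pushL2 v = (ρ g).pushL2 ((ρ h).pushL2 v) := by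
  obtain ⟨σ, hσ, rfl⟩ := v.exists_mk_eq
  simp only [BundleIsometry.pushL2_mk, BundleIsometry.pushFun_of_total (hρ g h)]

include hρ in
theorem pushL2_one_apply (v : L2Section 𝕜 I F V (riemannianVolume I M)) :
    (ρ 1).pushL2 v = v := by
  obtain ⟨σ, hσ, rfl⟩ := v.exists_mk_eq
  simp only [BundleIsometry.pushL2_mk,
    BundleIsometry.pushFun_of_total_eq_id (total_one_eq_id ρ hρ)]

/-- The unitary representation of `Γ` on `L²(V)` by push-forward. -/
noncomputable def pushRep : Γ →* (L2Section 𝕜 I F V (riemannianVolume I M) ≃ₗᵢ[𝕜]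
    L2Section 𝕜 I F V (riemannianVolume I M)) where
  toFun g :=
    { toLinearEquiv := LinearEquiv.ofLinearMap (ρ g).pushL2.toLinearMap (ρ g⁻¹).pushL2.toLinearMap
        (LinearMap.ext fun v => by
          change (ρ g).pushL2 ((ρ g⁻¹).pushL2 v) = v
          rw [← pushL2_mul_apply ρ hρ, mul_inv_cancel, pushL2_one_apply ρ hρ])
        (LinearMap.ext fun v => by
          change (ρ g⁻¹).pushL2 ((ρ g).pushL2 v) = v
          rw [← pushL2_mul_apply ρ hρ, inv_mul_cancel, pushL2_one_apply ρ hρ])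
      norm_map' := (ρ g).pushL2.norm_map }
  map_one' := LinearIsometryEquiv.ext fun v => pushL2_one_apply ρ hρ v
  map_mul' g h := LinearIsometryEquiv.ext fun v => pushL2_mul_apply ρ hρ g h v

theorem pushRep_apply (g : Γ) (v : L2Section 𝕜 I F V (riemannianVolume I M)) :
    pushRep ρ hρ g v = (ρ g).pushL2 v := rfl

theorem BundleIsometry.pushL2_mem_supportedIn (g : BundleIsometry 𝕜 I F V) {K : Set M}
    {v : L2Section 𝕜 I F V (riemannianVolume I M)}
    (hv : v ∈ supportedIn 𝕜 I F V (riemannianVolume I M) K) :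
    g.pushL2 v ∈ supportedIn 𝕜 I F V (riemannianVolume I M) (g.base '' K) := by
  obtain ⟨σ, hσ, h0, rfl⟩ := hv
  refine ⟨_, g.pushFun_mem_sqIntegrableSections hσ, fun y hy => ?_, rfl⟩
  by_contra h
  refine (g.pushFun_ne_zero_iff σ y).1 h (h0 _ fun hK => hy ?_)
  exact ⟨_, hK, g.base.apply_symm_apply y⟩

/-- If `Γ` moves every compact set off itself, then `L²(V)` has no nonzero finite-dimensional
subspace invariant under `Γ`. -/
theorem eq_bot_of_invariant_pushRep [T2Space M]
    (hΓ : ∀ K : Set M, IsCompact K → ∃ g : Γ, (ρ g).base '' K ∩ K = ∅)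
    (E : Submodule 𝕜 (L2Section 𝕜 I F V (riemannianVolume I M))) (hE : FiniteDimensional 𝕜 E)
    (hinv : ∀ g, ∀ v ∈ E, pushRep ρ hρ g v ∈ E) : E = ⊥ := by
  refine eq_bot_of_invariant_of_directed (fun K L => ⟨K ⊔ L, supportedIn_mono ?_,
    supportedIn_mono ?_⟩) (dense_iUnion_supportedIn (riemannianVolume I M)) (fun K => ?_) E hE hinv
  · exact subset_union_left
  · exact subset_union_right
  · obtain ⟨g, hg⟩ := hΓ K K.isCompact
    exact ⟨g, fun v hv w hw =>
      inner_eq_zero_of_supportedIn hg ((ρ g).pushL2_mem_supportedIn hv) hw⟩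

end PushForward

/-! ### Invariance of the boundary condition -/

section Boundary

variable {m : ℕ} {H : Type*} [TopologicalSpace H]
  {I : ModelWithCorners ℝ (EuclideanSpace ℝ (Fin m)) H}
  {M : Type*} [TopologicalSpace M] [ChartedSpace H M] [IsManifold I ∞ M]

theorem frontier_range_of_halfSpace {i : Fin m} (hi : range I = {v | 0 ≤ v i}) :
    frontier (range I) = {v | 0 = v i} := by
  rw [hi]
  exact frontier_halfSpace 2 0 i

theorem interior_range_of_halfSpace {i : Fin m} (hi : range I = {v | 0 ≤ v i}) :
    interior (range I) = {v | 0 < v i} := by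
  rw [hi]
  exact interior_halfSpace 2 0 i

/-- At a boundary point, the differential of a diffeomorphism multiplies the coordinate normal to
the boundary by a positive number, since this coordinate is minimal on the boundary. -/
theorem exists_pos_mfderiv_normal_coord {i : Fin m} (hi : range I = {v | 0 ≤ v i})
    (φ : M ≃ₘ^∞⟮I, I⟯ M) {x : M} (hx : I.IsBoundaryPoint x) :
    ∃ c : ℝ, 0 < c ∧ ∀ v : EuclideanSpace ℝ (Fin m),
      (show EuclideanSpace ℝ (Fin m) from mfderiv I I φ x v) i = c * v i := by
  have hφx : I.IsBoundaryPoint (φ x) :=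
    ((φ.isLocalDiffeomorph x).isBoundaryPoint_iff (by simp)).1 hx
  rw [ModelWithCorners.isBoundaryPoint_iff, frontier_range_of_halfSpace hi] at hx hφx
  have hd := ((φ.contMDiff.mdifferentiable (by simp)) x).hasMFDerivAt.2
  let L : EuclideanSpace ℝ (Fin m) →L[ℝ] EuclideanSpace ℝ (Fin m) := mfderiv I I φ x
  let ℓ : EuclideanSpace ℝ (Fin m) →L[ℝ] ℝ := (EuclideanSpace.proj i).comp L
  have hℓ : HasFDerivWithinAt (fun u => writtenInExtChartAt I I x φ u i) ℓ (range I)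
      (extChartAt I x x) :=
    (EuclideanSpace.proj (𝕜 := ℝ) i).hasFDerivAt.comp_hasFDerivWithinAt _ hd
  have hmin : IsLocalMinOn (fun u => writtenInExtChartAt I I x φ u i) (range I)
      (extChartAt I x x) := by
    refine IsMinOn.localize fun u _ => ?_
    have h0 : writtenInExtChartAt I I x φ (extChartAt I x x) i = 0 := by
      rw [writtenInExtChartAt, Function.comp_apply, Function.comp_apply,
        (extChartAt I x).left_inv (mem_extChartAt_source x)]
      exact hφx.symm
    have h1 : writtenInExtChartAt I I x φ u ∈ range I := by
      simp only [writtenInExtChartAt, Function.comp_apply, extChartAt_coe]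
      exact mem_range_self _
    rw [hi] at h1
    change writtenInExtChartAt I I x φ (extChartAt I x x) i ≤ writtenInExtChartAt I I x φ u i
    rw [h0]
    exact h1
  have hnonneg : ∀ v : EuclideanSpace ℝ (Fin m), 0 ≤ v i → 0 ≤ ℓ v := by
    intro v hv
    refine hmin.hasFDerivWithinAt_nonneg hℓ (mem_posTangentConeAt_of_segment_subset ?_)
    rw [hi]
    have hconv : Convex ℝ {v : EuclideanSpace ℝ (Fin m) | 0 ≤ v i} :=
      convex_halfSpace_ge (f := fun v : EuclideanSpace ℝ (Fin m) => v i)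
        ⟨fun _ _ => rfl, fun _ _ => rfl⟩ 0
    refine hconv.segment_subset (le_of_eq hx) ?_
    have hx' : (0 : ℝ) = extChartAt I x x i := hx
    change 0 ≤ extChartAt I x x i + v i
    rwa [← hx', zero_add]
  have hlin : ∀ v : EuclideanSpace ℝ (Fin m),
      ℓ v = ℓ (EuclideanSpace.single i 1) * v i := by
    intro v
    have h0 : (v - v i • EuclideanSpace.single i (1 : ℝ)) i = 0 := by simp
    have h1 := hnonneg (v - v i • EuclideanSpace.single i (1 : ℝ)) h0.ge
    have h2 := hnonneg (-(v - v i • EuclideanSpace.single i (1 : ℝ))) (by simp)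
    rw [map_neg] at h2
    have h3 : ℓ (v - v i • EuclideanSpace.single i (1 : ℝ)) = 0 := by linarith
    rw [map_sub, map_smul, smul_eq_mul, sub_eq_zero] at h3
    rw [h3, mul_comm]
  refine ⟨ℓ (EuclideanSpace.single i 1), lt_of_le_of_ne (hnonneg _ (by simp)) fun h => ?_, hlin⟩
  -- the differential is onto, so `ℓ` does not vanish
  obtain ⟨v, hv⟩ := (φ.mfderivToContinuousLinearEquiv (by simp) x).surjective
    (show EuclideanSpace ℝ (Fin m) from EuclideanSpace.single i (1 : ℝ))
  have hv' : L v = EuclideanSpace.single i (1 : ℝ) := hv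
  have h1 : ℓ v = 1 := by
    change (L v) i = 1
    rw [hv']
    simp
  rw [hlin v, ← h, zero_mul] at h1
  exact zero_ne_one h1

/-- The differential of an isometry pulls the inward unit normal back to the inward unit normal. -/
theorem isInwardUnitNormal_of_mfderiv [RiemannianBundle (fun x : M ↦ TangentSpace I x)]
    (hI : IsHalfSpaceModel I) {φ : M ≃ₘ^∞⟮I, I⟯ M}
    (hiso : ∀ (x : M) (v : TangentSpace I x), ‖mfderiv I I φ x v‖ = ‖v‖)
    {x : M} (hx : I.IsBoundaryPoint x) {n : TangentSpace I x}
    (hn : IsInwardUnitNormal I (φ x) (mfderiv I I φ x n)) : IsInwardUnitNormal I x n := by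
  have hφx : I.IsBoundaryPoint (φ x) :=
    ((φ.isLocalDiffeomorph x).isBoundaryPoint_iff (by simp)).1 hx
  obtain hu | ⟨i, hi⟩ := hI
  · rw [ModelWithCorners.isBoundaryPoint_iff, hu, frontier_univ] at hx
    exact hx.elim
  obtain ⟨c, hc, hcoord⟩ := exists_pos_mfderiv_normal_coord hi φ hx
  obtain ⟨hn1, hn2, hn3⟩ := hn
  rw [ModelWithCorners.isBoundaryPoint_iff, frontier_range_of_halfSpace hi] at hx hφx
  have hx' : (0 : ℝ) = extChartAt I x x i := hx
  have hφx' : (0 : ℝ) = extChartAt I (φ x) (φ x) i := hφx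
  rw [frontier_range_of_halfSpace hi] at hn2
  rw [interior_range_of_halfSpace hi] at hn3
  refine ⟨by rw [← hn1, hiso], fun v hv => ?_, ?_⟩
  · rw [frontier_range_of_halfSpace hi] at hv
    have hv' : (0 : ℝ) = extChartAt I x x i + v i := hv
    rw [← inner_map_map_of_norm _ (hiso x) n (show TangentSpace I x from v)]
    refine hn2 (mfderiv I I φ x v) ?_
    change (0 : ℝ) = extChartAt I (φ x) (φ x) i +
      (show EuclideanSpace ℝ (Fin m) from mfderiv I I φ x v) i
    rw [← hx', zero_add] at hv'
    rw [hcoord, ← hφx', ← hv', mul_zero, zero_add]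
  · rw [interior_range_of_halfSpace hi]
    have hn3' : (0 : ℝ) < extChartAt I (φ x) (φ x) i +
      (show EuclideanSpace ℝ (Fin m) from mfderiv I I φ x n) i := hn3
    rw [hcoord n, ← hφx', zero_add] at hn3'
    change (0 : ℝ) < extChartAt I x x i + (show EuclideanSpace ℝ (Fin m) from n) i
    rw [← hx', zero_add]
    exact (mul_pos_iff_of_pos_left hc).1 hn3'

variable {𝕜 : Type*} [RCLike 𝕜] [RiemannianBundle (fun x : M ↦ TangentSpace I x)]
  {F : Type*} [NormedAddCommGroup F] [NormedSpace 𝕜 F] [NormedSpace ℝ F] [IsScalarTower ℝ 𝕜 F]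
  {V : M → Type*} [TopologicalSpace (TotalSpace F V)]
  [∀ x, NormedAddCommGroup (V x)] [∀ x, InnerProductSpace 𝕜 (V x)]
  [∀ x, NormedSpace ℝ (V x)] [∀ x, IsScalarTower ℝ 𝕜 (V x)]
  [FiberBundle F V] [VectorBundle 𝕜 F V] [VectorBundle ℝ F V] [ContMDiffVectorBundle ∞ F V I]

theorem BundleIsometry.push_mem_boundaryDomain (hI : IsHalfSpaceModel I)
    {nabla : LinearConnection 𝕜 I F V} {a b : I.boundary M → 𝕜} {g : BundleIsometry 𝕜 I F V}
    (hnabla : nabla.IsInvariantAlongBoundary g)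
    (ha : ∀ x y : I.boundary M, g.base x = y → a y = a x)
    (hb : ∀ x y : I.boundary M, g.base x = y → b y = b x)
    {η : smoothSections 𝕜 I F V} (hη : η ∈ boundaryDomain nabla a b) :
    g.push η ∈ boundaryDomain nabla a b := by
  obtain ⟨hcpt, hbd⟩ := hη
  refine ⟨?_, ?_⟩
  · have h1 : {y | (g.push η).1 y ≠ 0} = g.base.toHomeomorph '' {x | η.1 x ≠ 0} := by
      ext y
      refine (g.pushFun_ne_zero_iff η.1 y).trans ⟨fun h => ⟨_, h, g.base.apply_symm_apply y⟩, ?_⟩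
      rintro ⟨x, hx, rfl⟩
      change η.1 (g.base.symm (g.base x)) ≠ 0
      rwa [g.base.symm_apply_apply]
    rw [h1, ← g.base.toHomeomorph.image_closure]
    exact hcpt.image g.base.continuous
  · rintro ⟨y, hy⟩ n hn
    obtain ⟨x, rfl⟩ := g.base_surjective y
    have hx : I.IsBoundaryPoint x :=
      ((g.base.isLocalDiffeomorph x).isBoundaryPoint_iff (by simp)).2 hy
    obtain ⟨ν, rfl⟩ := (g.base.mfderivToContinuousLinearEquiv (by simp) x).surjective n
    have hν := isInwardUnitNormal_of_mfderiv hI g.norm_mfderiv hx hn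
    have h1 := hbd ⟨x, hx⟩ ν hν
    have h2 : nabla.cov (g.push η).1 (g.base x) (mfderiv I I g.base x ν) =
        g.fiber x (nabla.cov η.1 x ν) := hnabla η x hx ν
    have h3 : (g.push η).1 (g.base x) = g.fiber x (η.1 x) := g.pushFun_base η.1 x
    change a ⟨g.base x, hy⟩ • nabla.cov (g.push η).1 (g.base x) (mfderiv I I g.base x ν) +
      b ⟨g.base x, hy⟩ • (g.push η).1 (g.base x) = 0
    rw [h2, h3, ha ⟨x, hx⟩ ⟨g.base x, hy⟩ rfl, hb ⟨x, hx⟩ ⟨g.base x, hy⟩ rfl,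
      ← (g.fiber x).map_smul, ← (g.fiber x).map_smul, ← (g.fiber x).map_add, h1,
      (g.fiber x).map_zero]

/-- A bundle isometry preserving `D` and the boundary condition preserves the graph of `D`. -/
theorem commutesWith_l2Operator [SecondCountableTopology M] [Nonempty M] [MeasurableSpace M]
    [BorelSpace M] [FiniteDimensional 𝕜 F] [IsSmoothFiberMetric 𝕜 I F V]
    (hI : IsHalfSpaceModel I)
    {nabla : LinearConnection 𝕜 I F V} {a b : I.boundary M → 𝕜}
    {D : smoothSections 𝕜 I F V →ₗ[𝕜] smoothSections 𝕜 I F V} {g : BundleIsometry 𝕜 I F V}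
    (hD : ∀ η, D (g.push η) = g.push (D η)) (hnabla : nabla.IsInvariantAlongBoundary g)
    (ha : ∀ x y : I.boundary M, g.base x = y → a y = a x)
    (hb : ∀ x y : I.boundary M, g.base x = y → b y = b x)
    {U : L2Section 𝕜 I F V (riemannianVolume I M) ≃ₗᵢ[𝕜]
      L2Section 𝕜 I F V (riemannianVolume I M)} (hU : ∀ v, U v = g.pushL2 v) :
    (l2Operator nabla a b D).CommutesWith U := by
  refine LinearPMap.commutesWith_toLinearPMap ?_
  rintro _ ⟨η, hη, h1, h2, rfl⟩
  have h3 : (D (g.push η)).1 = g.pushFun (D η).1 := by rw [hD]; rfl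
  have h4 : (D (g.push η)).1 ∈ sqIntegrableSections 𝕜 I F V (riemannianVolume I M) :=
    h3 ▸ g.pushFun_mem_sqIntegrableSections h2
  refine ⟨g.push η, g.push_mem_boundaryDomain hI hnabla ha hb hη,
    g.pushFun_mem_sqIntegrableSections h1, h4, ?_⟩
  rw [hU, hU]
  refine Prod.ext rfl ?_
  change g.pushL2 (L2Section.mk _ h2) = _
  rw [g.pushL2_mk]
  simp only [h3]

end Boundary

/-! ### The spectrum of the Friedrichs extension -/

theorem mainTheorem6 {𝕜 : Type*} [RCLike 𝕜]
    -- the connected smooth manifold `M`, with possibly empty smooth boundary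
    {m : ℕ} {H : Type*} [TopologicalSpace H]
    (I : ModelWithCorners ℝ (EuclideanSpace ℝ (Fin m)) H) (hI : IsHalfSpaceModel I)
    {M : Type*} [TopologicalSpace M] [ChartedSpace H M] [IsManifold I ∞ M]
    [T2Space M] [SecondCountableTopology M] [ConnectedSpace M]
    [MeasurableSpace M] [BorelSpace M]
    -- the Riemannian metric of `M`
    [RiemannianBundle (fun x : M ↦ TangentSpace I x)]
    [IsContMDiffRiemannianBundle I ∞ (EuclideanSpace ℝ (Fin m)) (fun x : M ↦ TangentSpace I x)]
    -- the Riemannian or Hermitian vector bundle `V`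
    {F : Type*} [NormedAddCommGroup F] [NormedSpace 𝕜 F] [NormedSpace ℝ F] [IsScalarTower ℝ 𝕜 F]
    [FiniteDimensional 𝕜 F]
    {V : M → Type*} [TopologicalSpace (TotalSpace F V)]
    [∀ x, NormedAddCommGroup (V x)] [∀ x, InnerProductSpace 𝕜 (V x)]
    [∀ x, NormedSpace ℝ (V x)] [∀ x, IsScalarTower ℝ 𝕜 (V x)]
    [FiberBundle F V] [VectorBundle 𝕜 F V] [VectorBundle ℝ F V] [ContMDiffVectorBundle ∞ F V I]
    [IsSmoothFiberMetric 𝕜 I F V]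
    -- the connection, the boundary condition and the differential operator
    (nabla : LinearConnection 𝕜 I F V) (a b : I.boundary M → 𝕜)
    (D : smoothSections 𝕜 I F V →ₗ[𝕜] smoothSections 𝕜 I F V) (hD : IsDifferentialOperator D)
    -- the group `Γ` of automorphisms
    {Γ : Type*} [Group Γ] (ρ : Γ → BundleIsometry 𝕜 I F V)
    (hρ : ∀ g h : Γ, (ρ (g * h)).total = (ρ g).total ∘ (ρ h).total)
    (hDΓ : ∀ (g : Γ) (η : smoothSections 𝕜 I F V), D ((ρ g).push η) = (ρ g).push (D η))
    (hnabla : ∀ g : Γ, nabla.IsInvariantAlongBoundary (ρ g))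
    (ha : ∀ (g : Γ) (x y : I.boundary M), (ρ g).base x = y → a y = a x)
    (hb : ∀ (g : Γ) (x y : I.boundary M), (ρ g).base x = y → b y = b x)
    (hΓ : ∀ K : Set M, IsCompact K → ∃ g : Γ, (ρ g).base '' K ∩ K = ∅)
    (hsymm : (l2Operator nabla a b D).IsSymmetricOp)
    (hbdd : (l2Operator nabla a b D).IsBoundedFromBelow) :
    ((l2Operator nabla a b D).friedrichs hbdd).spectrumSet =
        ((l2Operator nabla a b D).friedrichs hbdd).essentialSpectrum ∧
      ∀ z : 𝕜, ((l2Operator nabla a b D).friedrichs hbdd).IsEigenvalue z →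
        ¬ ((l2Operator nabla a b D).friedrichs hbdd).HasFiniteMultiplicity z := by
  have hcomm : ∀ g, ((l2Operator nabla a b D).friedrichs hbdd).CommutesWith (pushRep ρ hρ g) := by
    have h : ∀ g, (l2Operator nabla a b D).CommutesWith (pushRep ρ hρ g) := fun g =>
      commutesWith_l2Operator hI (hDΓ g) (hnabla g) (ha g) (hb g) (pushRep_apply ρ hρ g)
    intro g
    refine (h g).friedrichs ?_ hbdd
    have h' := h g⁻¹
    rwa [map_inv] at h'
  have hbot := eq_bot_of_invariant_pushRep ρ hρ hΓ
  exact ⟨LinearPMap.spectrumSet_eq_essentialSpectrum hcomm hbot,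
    fun z hz => LinearPMap.not_hasFiniteMultiplicity hcomm hbot hz⟩
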